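/- Let $p$ be a prime, $k$ a field of characteristic $p$, and $r\le n$ non-negative integers. **Monoids.** $\bar\tau_r$ is the monoid (under composition) of all maps $\alpha:\{0,\dots,r\}\to\{0,\dots,r\}$ with $\alpha(0)=0$; $\mathfrak S_r\subseteq\bar\tau_r$ is the symmetric group on $\{1,\dots,r\}$ (extended by $0\mapsto0$); the rook monoid is $\Re_r=\{\alpha\in\bar\tau_r : |\alpha^{-1}(i)|\le 1 \text{ for } 1\le i\le r\}$. Let $S_r$ be a submonoid of $\bar\tau_r$ with $\Re_r\subseteq S_r$. **The algebra $B_R$.** Let $\Lambda$ be the set of compositions $\lambda=(\lambda_1,\dots,\lambda_n)$ of $r$ with $n$ parts $\lambda_i\ge 0$, and $\Lambda^+\subseteq\Lambda$ the set of partitions (weakly decreasing compositions). The $\lambda$-blocks are the consecutive intervals of $\{1,\dots,r\}$ of lengths $\lambda_1,\dots,\lambda_n$, and $G_\lambda\subseteq\mathfrak S_r$ is the Young subgroup of the permutations preserving each $\lambda$-block. For $\alpha\in S_r$ let $D_\alpha=G_\lambda\alpha G_\mu$, and let $n_R(D_\alpha)=n_R(\lambda,\alpha,\mu)$ be the order of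 $\{\sigma\in G_\lambda:\exists\pi\in G_\mu,\ \sigma\alpha=\alpha\pi\}$. The right generalized Schur algebra $B_R$ is the $k$-algebra with basis $f(\lambda,D,\mu)$ ($\lambda,\mu\in\Lambda$, $D\in G_\lambda\backslash S_r/G_\mu$), where $f(\lambda,\alpha,\mu)=f(\lambda,D_\alpha,\mu)$, with product $f(\lambda,\alpha,\nu)f(\omega,\beta,\mu)=0$ if $\nu\ne\omega$ and $$f(\lambda,\alpha,\nu)f(\nu,\beta,\mu)=\sum_{D}\frac{n_R(D)\,\#\{\rho\in G_\nu:\alpha\rho\beta\in D\}}{n_R(\lambda,\alpha,\nu)\,n_R(\nu,\beta,\mu)}\,f(\lambda,D,\mu),$$ the coefficients being integers. **The algebra $C_R^\lambda$.** Put $1_\lambda=f(\lambda,1,\lambda)$. For $\nu\in\Lambda$ and $\lambda\in\Lambda^+$ write $\nu<\lambda$ if the partition obtained by rearranging $\nu$ is lexicographically smaller than $\lambda$, and let $e_\lambda=\sum_{\nu<\lambda}1_\nu$. Put $B_R^\lambda=1_\lambda B_R1_\lambda$ and $C_R^\lambda=B_R^\lambda/(B_Re_\lambda B_R\cap B_R^\lambda)$,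 with projection $\Pi_R:B_R^\lambda\to C_R^\lambda$. **The submonoid $S'$.** Let $\lambda\in\Lambda^+$ be a $p$-partition, that is, every non-zero part is a power $p^i$ ($i\ge0$), and let $s_i$ be the number of parts equal to $p^i$. Fill the Young diagram of $\lambda$ with $1,\dots,r$ row by row. Let $\phi_\lambda:\prod_{s_i>0}\bar\tau_{s_i}\to\bar\tau_r$ be the injective homomorphism for which $\phi_\lambda((\alpha_i)_i)$ maps the $b$-th entry of the $a$-th row of length $p^i$ to the $b$-th entry of the $\alpha_i(a)$-th row of length $p^i$ if $\alpha_i(a)\neq0$, and to $0$ if $\alpha_i(a)=0$. (For $s_i=0$ the factors $\bar\tau_{s_i}$, $\mathfrak S_{s_i}$ are read as trivial.) Let $S_r^\lambda=\operatorname{im}(\phi_\lambda)\cap S_r$, let $\psi_{\lambda,R}:k[S_r^\lambda]\to B_R^\lambda$ be the $k$-linear map $\alpha\mapsto f(\lambda,\alpha,\lambda)$, and let $$S'=\phi_\lambda\Big(\bar\tau_{s_0}\cdot\prod_{i>0}\mathfrak S_{s_i}\Big)\cap S_r^\lambda .$$ **Proposition 8.4.** The map $\Pi_R\circ\psi_{\lambda,R}$,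 restricted to $k[S']$, is an isomorphism of $k$-algebras $k[S']\to C_R^\lambda$. Moreover there is a submonoid $S_0$ with $\Re_{s_0}\subseteq S_0\subseteq\bar\tau_{s_0}$ such that $S'=\phi_\lambda\big(S_0\cdot\prod_{i>0}\mathfrak S_{s_i}\big)$, and there are isomorphisms of $k$-algebras $$C_R^\lambda\;\cong\;k[S']\;\cong\;k\Big[S_0\cdot\prod_{i>0}\mathfrak S_{s_i}\Big]\;\cong\;k[S_0]\otimes_k\Big(\bigotimes_{i>0,\ s_i>0}k[\mathfrak S_{s_i}]\Big).$$ -/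

import Mathlib

open scoped TensorProduct

namespace GenSchur

/-! ## Transformation monoids -/

/-- The maps `α : {0,…,r} → {0,…,r}` with `α 0 = 0`, as a submonoid of all self-maps of
`{0,…,r}` under composition. -/
def ptSub (r : ℕ) : Submonoid (Function.End (Fin (r + 1))) where
  carrier := {α | α 0 = 0}
  one_mem' := rfl
  mul_mem' := by
    intro a b ha hb
    change a (b 0) = 0
    rw [show b 0 = 0 from hb]
    exact ha

/-- The monoid `τ̄_r` of all maps `α : {0,…,r} → {0,…,r}` with `α 0 = 0`, under composition. -/
abbrev PT (r : ℕ) : Type := ptSub r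

/-- `α x` for `α ∈ τ̄_r`. -/
def PT.app {r : ℕ} (α : PT r) (x : Fin (r + 1)) : Fin (r + 1) := α.1 x

@[simp] theorem PT.app_zero {r : ℕ} (α : PT r) : α.app 0 = 0 := α.2

@[simp] theorem PT.one_app {r : ℕ} (x : Fin (r + 1)) : (1 : PT r).app x = x := rfl

@[simp] theorem PT.mul_app {r : ℕ} (α β : PT r) (x : Fin (r + 1)) :
    (α * β).app x = α.app (β.app x) := rfl

theorem PT.ext {r : ℕ} {α β : PT r} (h : ∀ x, α.app x = β.app x) : α = β :=
  Subtype.ext (funext h)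

/-- Build `α ∈ τ̄_r` from its values on `1,…,r`. -/
def PT.mk {r : ℕ} (f : Fin r → Fin (r + 1)) : PT r :=
  ⟨fun x => Fin.cases (motive := fun _ => Fin (r + 1)) 0 f x, Eq.refl (0 : Fin (r + 1))⟩

@[simp] theorem PT.mk_app_succ {r : ℕ} (f : Fin r → Fin (r + 1)) (x : Fin r) :
    (PT.mk f).app x.succ = f x := rfl

/-- The inclusion `𝔖_r → τ̄_r`; the point `x : Fin r` stands for the element `x + 1`
of `{1,…,r}`. -/
def permHom (r : ℕ) : Equiv.Perm (Fin r) →* PT r where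
  toFun σ := PT.mk fun x => (σ x).succ
  map_one' := by
    refine PT.ext fun x => ?_
    refine Fin.cases ?_ (fun y => ?_) x <;> simp
  map_mul' σ τ := by
    refine PT.ext fun x => ?_
    refine Fin.cases ?_ (fun y => ?_) x <;> simp

/-- The symmetric group `𝔖_r` as a submonoid of `τ̄_r`. -/
def symSub (r : ℕ) : Submonoid (PT r) := MonoidHom.mrange (permHom r)

/-- The rook monoid `ℜ_r`: every `i ≠ 0` has at most one preimage. -/
def rook (r : ℕ) : Submonoid (PT r) where
  carrier := {α | ∀ i, i ≠ 0 → ∀ x y, α.app x = i → α.app y = i → x = y}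
  one_mem' := by
    intro i _ x y hx hy
    exact hx.trans hy.symm
  mul_mem' := by
    intro a b ha hb i hi x y hx hy
    have hxy : b.app x = b.app y := ha i hi _ _ hx hy
    refine hb (b.app x) (fun h0 => hi ?_) x y rfl hxy.symm
    rw [← hx, PT.mul_app, h0, PT.app_zero]

/-- A monoid `S_r` with `𝔖_r ⊆ S_r ⊆ τ̄_r`. -/
structure TransMonoid (r : ℕ) where
  toSubmonoid : Submonoid (PT r)
  sym_le : symSub r ≤ toSubmonoid

/-- The elements of `S_r`. -/
abbrev TransMonoid.Elt {r : ℕ} (S : TransMonoid r) : Type := S.toSubmonoid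

/-- The inclusion `𝔖_r → S_r`. -/
def TransMonoid.perm {r : ℕ} (S : TransMonoid r) : Equiv.Perm (Fin r) →* S.Elt :=
  (permHom r).codRestrict S.toSubmonoid fun σ => S.sym_le ⟨σ, rfl⟩

/-! ## Compositions, blocks, Young subgroups -/

/-- `Λ(r,n)`: compositions of `r` with `n` parts (zero parts are allowed). -/
def Comp (r n : ℕ) : Type := {l : Fin n → ℕ // ∑ i, l i = r}

instance (r n : ℕ) : Finite (Comp r n) := by
  let F : Comp r n → (Fin n → Fin (r + 1)) := fun l i =>
    ⟨l.1 i, Nat.lt_succ_of_le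
      ((Finset.single_le_sum (fun _ _ => Nat.zero_le _) (Finset.mem_univ i)).trans l.2.le)⟩
  refine Finite.of_injective F fun a b h => Subtype.ext (funext fun i => ?_)
  exact congrArg Fin.val (congrFun h i)

noncomputable instance (r n : ℕ) : Fintype (Comp r n) := Fintype.ofFinite _

noncomputable instance (r n : ℕ) : DecidableEq (Comp r n) := Classical.decEq _

/-- The bijection sending `(j, b)` to the `b`-th element of the `j`-th block, where the blocks
are consecutive intervals of lengths `λ_1, …, λ_n` (all indices start at `0`): the image of
`(j, b)` is `λ_1 + ⋯ + λ_{j-1} + b`. -/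
def cell {r n : ℕ} (l : Comp r n) : (Σ j : Fin n, Fin (l.1 j)) ≃ Fin r :=
  finSigmaFinEquiv.trans (finCongr l.2)

/-- The index of the `λ`-block containing `x`. -/
def row {r n : ℕ} (l : Comp r n) (x : Fin r) : Fin n := ((cell l).symm x).1

/-- The Young subgroup `𝔖_λ = G_λ`: the permutations which map every `λ`-block to itself. -/
def young {r n : ℕ} (l : Comp r n) : Subgroup (Equiv.Perm (Fin r)) where
  carrier := {σ | ∀ x, row l (σ x) = row l x}
  one_mem' := fun _ => rfl
  mul_mem' := fun {a b} ha hb x => (ha (b x)).trans (hb x)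
  inv_mem' := fun {a} ha x => by
    have h := ha (a⁻¹ x)
    rw [← Equiv.Perm.mul_apply, mul_inv_cancel, Equiv.Perm.one_apply] at h
    exact h.symm

noncomputable instance {r n : ℕ} (l : Comp r n) : Fintype (young l) := Fintype.ofFinite _

/-- `L(λ,k)`: the number of rows of length `k`. -/
def numRows {r n : ℕ} (l : Comp r n) (k : ℕ) : ℕ :=
  (Finset.univ.filter fun i => l.1 i = k).card

/-- Partitions: weakly decreasing compositions. -/
def IsPartition {r n : ℕ} (l : Comp r n) : Prop := Antitone l.1

/-- `λ ∼ μ`: the same number of rows of each length. -/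
def Equi {r n : ℕ} (l m : Comp r n) : Prop := ∀ k, numRows l k = numRows m k

/-- The lexicographic order, used for partitions. -/
def lexLT {r n : ℕ} (l m : Comp r n) : Prop := ∃ k, (∀ i, i < k → l.1 i = m.1 i) ∧ l.1 k < m.1 k

/-- `ν < λ` for compositions: the partition rearranging `ν` is lexicographically smaller than the
partition rearranging `λ`. -/
def compLT {r n : ℕ} (v l : Comp r n) : Prop :=
  ∃ v' l' : Comp r n, IsPartition v' ∧ Equi v v' ∧ IsPartition l' ∧ Equi l l' ∧ lexLT v' l'

/-! ## Double cosets and structure constants -/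

section DoubleCosets

variable {r n : ℕ} (S : TransMonoid r)

/-- `α` and `β` lie in the same double coset: `β = σ α π` with `σ ∈ G_λ`, `π ∈ G_μ`. -/
def dcSetoid (l m : Comp r n) : Setoid S.Elt where
  r α β := ∃ σ ∈ young l, ∃ π ∈ young m, S.perm σ * α * S.perm π = β
  iseqv :=
    { refl := fun α => ⟨1, one_mem _, 1, one_mem _, by simp⟩
      symm := by
        rintro α β ⟨σ, hσ, π, hπ, rfl⟩
        refine ⟨σ⁻¹, inv_mem hσ, π⁻¹, inv_mem hπ, ?_⟩
        simp only [mul_assoc, ← map_mul, mul_inv_cancel, map_one, mul_one]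
        simp only [← mul_assoc, ← map_mul, inv_mul_cancel, map_one, one_mul]
      trans := by
        rintro α β γ ⟨σ, hσ, π, hπ, rfl⟩ ⟨σ', hσ', π', hπ', rfl⟩
        refine ⟨σ' * σ, mul_mem hσ' hσ, π * π', mul_mem hπ hπ', ?_⟩
        simp only [map_mul, mul_assoc] }

/-- `_λM_μ`: the set of double cosets `G_λ α G_μ`, `α ∈ S_r`. -/
def DC (l m : Comp r n) : Type := Quotient (dcSetoid S l m)

/-- The double coset `D(λ,α,μ) = G_λ α G_μ`. -/
def dc (l m : Comp r n) (α : S.Elt) : DC S l m := Quotient.mk (dcSetoid S l m) α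

instance (l m : Comp r n) : Finite (DC S l m) := by
  have : Finite S.Elt := by
    have : Finite (Function.End (Fin (r + 1))) :=
      inferInstanceAs (Finite (Fin (r + 1) → Fin (r + 1)))
    infer_instance
  exact inferInstanceAs (Finite (Quotient (dcSetoid S l m)))

noncomputable instance (l m : Comp r n) : Fintype (DC S l m) := Fintype.ofFinite _

noncomputable instance (l m : Comp r n) : DecidableEq (DC S l m) := Classical.decEq _

variable {S}

theorem dc_eq_iff {l m : Comp r n} {α β : S.Elt} :
    dc S l m α = dc S l m β ↔ ∃ σ ∈ young l, ∃ π ∈ young m, S.perm σ * α * S.perm π = β :=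
  Quotient.eq (r := dcSetoid S l m)

theorem dc_mul_left {l m : Comp r n} (α : S.Elt) {σ : Equiv.Perm (Fin r)} (hσ : σ ∈ young l) :
    dc S l m (S.perm σ * α) = dc S l m α :=
  (dc_eq_iff.2 ⟨σ, hσ, 1, one_mem _, by simp⟩).symm

theorem dc_mul_right {l m : Comp r n} (α : S.Elt) {π : Equiv.Perm (Fin r)} (hπ : π ∈ young m) :
    dc S l m (α * S.perm π) = dc S l m α :=
  (dc_eq_iff.2 ⟨1, one_mem _, π, hπ, by simp⟩).symm

theorem DC.ind {l m : Comp r n} {P : DC S l m → Prop} (h : ∀ α, P (dc S l m α)) (D) : P D :=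
  Quotient.ind h D

/-- The group `G_R(λ,α,μ)` of all `σ ∈ G_λ` with `σ α = α π` for some `π ∈ G_μ`. -/
def GR (l m : Comp r n) (α : S.Elt) : Subgroup (Equiv.Perm (Fin r)) where
  carrier := {σ | σ ∈ young l ∧ ∃ π ∈ young m, S.perm σ * α = α * S.perm π}
  one_mem' := ⟨one_mem _, 1, one_mem _, by simp⟩
  mul_mem' := by
    rintro a b ⟨ha, π, hπ, h⟩ ⟨hb, ρ, hρ, h'⟩
    exact ⟨mul_mem ha hb, π * ρ, mul_mem hπ hρ, by
      rw [map_mul, mul_assoc, h', ← mul_assoc, h, mul_assoc, map_mul]⟩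
  inv_mem' := by
    rintro a ⟨ha, π, hπ, h⟩
    refine ⟨inv_mem ha, π⁻¹, inv_mem hπ, ?_⟩
    calc S.perm a⁻¹ * α = S.perm a⁻¹ * (α * S.perm π) * S.perm π⁻¹ := by
          simp only [mul_assoc, ← map_mul, mul_inv_cancel, map_one, mul_one]
      _ = α * S.perm π⁻¹ := by
          rw [← h]
          simp only [← mul_assoc, ← map_mul, inv_mul_cancel, map_one, one_mul]

theorem card_GR_congr (l m : Comp r n) {α β : S.Elt} (h : dc S l m α = dc S l m β) :
    Nat.card (GR l m α) = Nat.card (GR l m β) := by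
  obtain ⟨σ, hσ, π, hπ, rfl⟩ := dc_eq_iff.1 h
  refine Nat.card_congr ((MulAut.conj σ).toEquiv.subtypeEquiv fun τ => ?_)
  change (τ ∈ young l ∧ _) ↔ (σ * τ * σ⁻¹ ∈ young l ∧ _)
  refine and_congr ?_ ?_
  · rw [Subgroup.mul_mem_cancel_right _ (inv_mem hσ), Subgroup.mul_mem_cancel_left _ hσ]
  · constructor
    · rintro ⟨ρ, hρ, e⟩
      refine ⟨π⁻¹ * ρ * π, mul_mem (mul_mem (inv_mem hπ) hρ) hπ, ?_⟩
      calc S.perm (σ * τ * σ⁻¹) * (S.perm σ * α * S.perm π)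
          = S.perm σ * (S.perm τ * α) * S.perm π := by
            rw [← mul_assoc, ← mul_assoc, ← map_mul, inv_mul_cancel_right, map_mul,
              mul_assoc (S.perm σ)]
        _ = S.perm σ * α * S.perm π * S.perm (π⁻¹ * ρ * π) := by
            rw [e, mul_assoc _ (S.perm π), ← map_mul, mul_assoc π⁻¹, mul_inv_cancel_left, map_mul]
            simp only [mul_assoc]
    · rintro ⟨ρ, hρ, e⟩
      change S.perm (σ * τ * σ⁻¹) * _ = _ at e
      refine ⟨π * ρ * π⁻¹, mul_mem (mul_mem hπ hρ) (inv_mem hπ), ?_⟩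
      calc S.perm τ * α
          = S.perm σ⁻¹ * (S.perm (σ * τ * σ⁻¹) * (S.perm σ * α * S.perm π)) * S.perm π⁻¹ := by
            simp only [← mul_assoc, ← map_mul, inv_mul_cancel_right, inv_mul_cancel, one_mul]
            simp only [mul_assoc, ← map_mul, mul_inv_cancel, map_one, mul_one]
        _ = α * S.perm (π * ρ * π⁻¹) := by
            rw [e]
            simp only [← mul_assoc, ← map_mul, inv_mul_cancel, map_one, one_mul]
            simp only [mul_assoc, ← map_mul]

/-- `n_R(D)`: the order of `G_R(λ,α,μ)` for any `α ∈ D`. -/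
noncomputable def nR {l m : Comp r n} (D : DC S l m) : ℕ :=
  Quotient.lift (s := dcSetoid S l m) (fun α => Nat.card (GR l m α))
    (fun _ _ h => card_GR_congr l m (Quotient.sound h)) D

theorem nR_dc (l m : Comp r n) (α : S.Elt) : nR (dc S l m α) = Nat.card (GR l m α) := rfl

theorem nR_pos {l m : Comp r n} (D : DC S l m) : 0 < nR D := by
  induction D using DC.ind with
  | h α => rw [nR_dc]; exact Nat.card_pos

theorem card_N_congr {l v m : Comp r n} (D : DC S l m) {α α' β β' : S.Elt}
    (hα : dc S l v α = dc S l v α') (hβ : dc S v m β = dc S v m β') :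
    Nat.card {ρ : young v // dc S l m (α * S.perm ρ * β) = D} =
      Nat.card {ρ : young v // dc S l m (α' * S.perm ρ * β') = D} := by
  obtain ⟨σ, hσ, π, hπ, rfl⟩ := dc_eq_iff.1 hα
  obtain ⟨σ', hσ', π', hπ', rfl⟩ := dc_eq_iff.1 hβ
  refine Nat.card_congr (Equiv.subtypeEquiv
    ((Equiv.mulLeft (⟨π, hπ⟩ : young v)⁻¹).trans (Equiv.mulRight (⟨σ', hσ'⟩ : young v)⁻¹))
    fun ρ => ?_)
  have : S.perm σ * α * S.perm π *
      S.perm (((⟨π, hπ⟩ : young v)⁻¹ * ρ * (⟨σ', hσ'⟩ : young v)⁻¹ : young v) :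
        Equiv.Perm (Fin r)) * (S.perm σ' * β * S.perm π') =
      S.perm σ * ((α * S.perm ρ * β) * S.perm π') := by
    simp only [Subgroup.coe_mul, Subgroup.coe_inv]
    have e : S.perm π * S.perm (π⁻¹ * (ρ : Equiv.Perm (Fin r)) * σ'⁻¹) * S.perm σ' =
        S.perm ρ := by
      rw [← map_mul, ← map_mul]
      congr 1
      group
    calc _ = S.perm σ * (α * (S.perm π * S.perm (π⁻¹ * (ρ : Equiv.Perm (Fin r)) * σ'⁻¹) *
          S.perm σ') * β * S.perm π') := by simp only [mul_assoc]
      _ = _ := by rw [e]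
  change _ ↔ dc S l m (_ * S.perm (((⟨π, hπ⟩ : young v)⁻¹ * ρ * (⟨σ', hσ'⟩ : young v)⁻¹ :
    young v) : Equiv.Perm (Fin r)) * _) = D
  rw [this, dc_mul_left _ hσ, dc_mul_right _ hπ']

/-- `N(D_α, D_β, D)`: the number of `ρ ∈ G_ν` with `α ρ β ∈ D`. -/
noncomputable def numN {l v m : Comp r n} (D₁ : DC S l v) (D₂ : DC S v m) (D : DC S l m) : ℕ :=
  Quotient.lift₂ (s₁ := dcSetoid S l v) (s₂ := dcSetoid S v m)
    (fun α β => Nat.card {ρ : young v // dc S l m (α * S.perm ρ * β) = D})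
    (fun _ _ _ _ h h' => card_N_congr D (Quotient.sound h) (Quotient.sound h')) D₁ D₂

theorem numN_dc {l v m : Comp r n} (α β : S.Elt) (D : DC S l m) :
    numN (dc S l v α) (dc S v m β) D =
      Nat.card {ρ : young v // dc S l m (α * S.perm ρ * β) = D} := rfl

/-- The structure constant `n_R(D) N(D₁,D₂,D) / (n_R(D₁) n_R(D₂))`; the division is exact
(`structConst_spec`). -/
noncomputable def structConst {l v m : Comp r n}
    (D₁ : DC S l v) (D₂ : DC S v m) (D : DC S l m) : ℕ :=
  nR D * numN D₁ D₂ D / (nR D₁ * nR D₂)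

theorem card_dvd_sum {G : Type*} [Group G] [Fintype G] (H : Subgroup G) (q : ℕ) (F : G → ℕ)
    (hF : ∀ g, ∀ h ∈ H, F (g * h) = F g) (hq : ∀ g, q ∣ F g) :
    Nat.card H * q ∣ ∑ g, F g := by
  classical
  have : ∑ g, F g = ∑ x : G ⧸ H, Nat.card H * F x.out := by
    rw [← Finset.sum_fiberwise Finset.univ (fun g : G => (g : G ⧸ H)) F]
    refine Finset.sum_congr rfl fun x _ => ?_
    have h1 : ∀ g ∈ Finset.univ.filter (fun g : G => (g : G ⧸ H) = x), F g = F x.out := by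
      intro g hg
      have hg' : (g : G ⧸ H) = x := (Finset.mem_filter.1 hg).2
      have h2 : ((x.out : G) : G ⧸ H) = (g : G ⧸ H) := by rw [hg']; exact Quotient.out_eq' x
      have h3 := hF x.out _ (QuotientGroup.eq.1 h2)
      rwa [mul_inv_cancel_left] at h3
    rw [Finset.sum_congr rfl h1, Finset.sum_const, smul_eq_mul]
    congr 1
    rw [← Fintype.card_subtype, ← Nat.card_eq_fintype_card]
    refine Nat.card_congr ?_
    refine Equiv.subtypeEquiv (Equiv.mulLeft (x.out : G)⁻¹) fun g => ?_
    change (g : G ⧸ H) = x ↔ (x.out : G)⁻¹ * g ∈ H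
    rw [← QuotientGroup.eq, show ((x.out : G) : G ⧸ H) = x from Quotient.out_eq' x]
    exact eq_comm
  rw [this]
  exact Finset.dvd_sum fun x _ => mul_dvd_mul_left _ (hq _)

theorem nat_card_subgroupOf {G : Type*} [Group G] {H K : Subgroup G} (h : H ≤ K) :
    Nat.card (H.subgroupOf K) = Nat.card H :=
  Nat.card_congr (Subgroup.subgroupOfEquivOfLe h).toEquiv

theorem GR_le (l m : Comp r n) (α : S.Elt) : GR l m α ≤ young l := fun _ h => h.1

theorem structConst_dvd {l v m : Comp r n} (D₁ : DC S l v) (D₂ : DC S v m) (D : DC S l m) :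
    nR D₁ * nR D₂ ∣ nR D * numN D₁ D₂ D := by
  classical
  induction D₁ using DC.ind with
  | h α =>
  induction D₂ using DC.ind with
  | h β =>
  induction D using DC.ind with
  | h γ =>
  let P : young l → young v → Prop := fun σ ρ =>
    ∃ π ∈ young m, S.perm σ * (α * S.perm ρ * β) = γ * S.perm π
  let F : young l → ℕ := fun σ => ∑ ρ : young v, if P σ ρ then 1 else 0
  have hA : nR (dc S l m γ) * numN (dc S l v α) (dc S v m β) (dc S l m γ) = ∑ σ, F σ := by
    have h1 : ∀ ρ : young v, (∑ σ : young l, if P σ ρ then 1 else 0) =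
        if dc S l m (α * S.perm ρ * β) = dc S l m γ then nR (dc S l m γ) else 0 := by
      intro ρ
      simp only [P]
      generalize α * S.perm ρ * β = δ
      split_ifs with h
      · rw [← h, nR_dc, ← Finset.card_filter, ← Fintype.card_subtype,
          ← Nat.card_eq_fintype_card, ← nat_card_subgroupOf (GR_le l m δ)]
        obtain ⟨σ₀, hσ₀, π₀, hπ₀, e⟩ := dc_eq_iff.1 h
        refine Nat.card_congr
          ((Equiv.mulLeft (⟨σ₀, hσ₀⟩ : young l)⁻¹).subtypeEquiv fun σ => ?_)
        change (∃ π ∈ young m, S.perm (σ : Equiv.Perm (Fin r)) * δ = γ * S.perm π) ↔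
          (σ₀⁻¹ * (σ : Equiv.Perm (Fin r)) ∈ young l ∧ ∃ π ∈ young m,
            S.perm (σ₀⁻¹ * (σ : Equiv.Perm (Fin r))) * δ = δ * S.perm π)
        rw [and_iff_right (mul_mem (inv_mem hσ₀) σ.2)]
        constructor
        · rintro ⟨π, hπ, e'⟩
          refine ⟨π₀ * π, mul_mem hπ₀ hπ, ?_⟩
          rw [map_mul, mul_assoc, e', ← e, map_mul]
          simp only [← mul_assoc, ← map_mul, inv_mul_cancel, map_one, one_mul]
          simp only [mul_assoc, map_mul]
        · rintro ⟨π, hπ, e'⟩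
          refine ⟨π₀⁻¹ * π, mul_mem (inv_mem hπ₀) hπ, ?_⟩
          calc S.perm σ * δ = S.perm σ₀ * (S.perm (σ₀⁻¹ * σ) * δ) := by
                rw [← mul_assoc, ← map_mul, mul_inv_cancel_left]
            _ = γ * S.perm (π₀⁻¹ * π) := by
                rw [e', ← e]
                simp only [mul_assoc, ← map_mul, mul_inv_cancel_left]
      · refine Finset.sum_eq_zero fun σ _ => if_neg ?_
        rintro ⟨π, hπ, e'⟩
        exact h (by rw [← dc_mul_left _ σ.2, e', dc_mul_right _ hπ])
    rw [Finset.sum_comm, Finset.sum_congr rfl fun ρ _ => h1 ρ, ← Finset.sum_filter,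
      Finset.sum_const, smul_eq_mul, mul_comm, numN_dc, Nat.card_eq_fintype_card,
      Fintype.card_subtype]
  rw [hA, nR_dc, nR_dc, ← nat_card_subgroupOf (GR_le l v α)]
  refine card_dvd_sum _ _ F ?_ ?_
  · rintro σ τ ⟨hτ, π₀, hπ₀, e⟩
    refine Fintype.sum_equiv (Equiv.mulLeft (⟨π₀, hπ₀⟩ : young v)) _ _ fun ρ => ?_
    have : S.perm ((σ * τ : young l) : Equiv.Perm (Fin r)) * (α * S.perm ρ * β) =
        S.perm σ * (α * S.perm (((⟨π₀, hπ₀⟩ : young v) * ρ : young v) :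
          Equiv.Perm (Fin r)) * β) := by
      have e' : S.perm (τ : Equiv.Perm (Fin r)) * α = α * S.perm π₀ := e
      rw [Subgroup.coe_mul, Subgroup.coe_mul, map_mul, map_mul]
      calc _ = S.perm σ * ((S.perm (τ : Equiv.Perm (Fin r)) * α) * S.perm ρ * β) := by
            simp only [mul_assoc]
        _ = _ := by
            rw [e']
            simp only [mul_assoc]
    refine if_congr ?_ rfl rfl
    simp only [P, this, Equiv.coe_mulLeft]
  · intro σ
    rw [← nat_card_subgroupOf (GR_le v m β), ← mul_one (Nat.card _)]
    refine card_dvd_sum _ _ _ ?_ fun _ => one_dvd _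
    rintro ρ κ ⟨hκ, π₀, hπ₀, e⟩
    have e' : S.perm (κ : Equiv.Perm (Fin r)) * β = β * S.perm π₀ := e
    have : S.perm σ * (α * S.perm ((ρ * κ : young v) : Equiv.Perm (Fin r)) * β) =
        S.perm σ * (α * S.perm ρ * β) * S.perm π₀ := by
      rw [Subgroup.coe_mul, map_mul, mul_assoc α, mul_assoc (S.perm _) _ β, e']
      simp only [mul_assoc]
    refine if_congr ?_ rfl rfl
    simp only [P, this]
    constructor
    · rintro ⟨π, hπ, h⟩
      refine ⟨π * π₀⁻¹, mul_mem hπ (inv_mem hπ₀), ?_⟩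
      rw [map_mul, ← mul_assoc γ, ← h]
      simp only [mul_assoc, ← map_mul, mul_inv_cancel, map_one, mul_one]
    · rintro ⟨π, hπ, h⟩
      exact ⟨π * π₀, mul_mem hπ hπ₀, by rw [h, map_mul, mul_assoc]⟩

theorem structConst_spec {l v m : Comp r n} (D₁ : DC S l v) (D₂ : DC S v m) (D : DC S l m) :
    structConst D₁ D₂ D * (nR D₁ * nR D₂) = nR D * numN D₁ D₂ D :=
  Nat.div_mul_cancel (structConst_dvd D₁ D₂ D)

theorem sum_numN {l v m : Comp r n} (α β : S.Elt) (g : DC S l m → ℕ) :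
    ∑ D, numN (dc S l v α) (dc S v m β) D * g D =
      ∑ ρ : young v, g (dc S l m (α * S.perm ρ * β)) := by
  classical
  rw [← Finset.sum_fiberwise Finset.univ
    (fun ρ : young v => dc S l m (α * S.perm ρ * β))]
  refine Finset.sum_congr rfl fun D _ => ?_
  rw [Finset.sum_congr rfl (g := fun _ => g D) fun ρ hρ => by rw [(Finset.mem_filter.1 hρ).2],
    Finset.sum_const, smul_eq_mul, numN_dc, Nat.card_eq_fintype_card, Fintype.card_subtype]

theorem structConst_assoc {l v w m : Comp r n}
    (D₁ : DC S l v) (D₂ : DC S v w) (D₃ : DC S w m) (E : DC S l m) :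
    ∑ D, structConst D₁ D₂ D * structConst D D₃ E =
      ∑ D, structConst D₂ D₃ D * structConst D₁ D E := by
  have hpos : 0 < nR D₁ * nR D₂ * nR D₃ :=
    Nat.mul_pos (Nat.mul_pos (nR_pos _) (nR_pos _)) (nR_pos _)
  refine Nat.eq_of_mul_eq_mul_right hpos ?_
  have hL : (∑ D, structConst D₁ D₂ D * structConst D D₃ E) * (nR D₁ * nR D₂ * nR D₃) =
      nR E * ∑ D, numN D₁ D₂ D * numN D D₃ E := by
    rw [Finset.sum_mul, Finset.mul_sum]
    refine Finset.sum_congr rfl fun D _ => ?_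
    calc _ = structConst D₁ D₂ D * (nR D₁ * nR D₂) * structConst D D₃ E * nR D₃ := by ring
      _ = numN D₁ D₂ D * (structConst D D₃ E * (nR D * nR D₃)) := by
        rw [structConst_spec]; ring
      _ = _ := by rw [structConst_spec]; ring
  have hR : (∑ D, structConst D₂ D₃ D * structConst D₁ D E) * (nR D₁ * nR D₂ * nR D₃) =
      nR E * ∑ D, numN D₂ D₃ D * numN D₁ D E := by
    rw [Finset.sum_mul, Finset.mul_sum]
    refine Finset.sum_congr rfl fun D _ => ?_
    calc _ = structConst D₂ D₃ D * (nR D₂ * nR D₃) * structConst D₁ D E * nR D₁ := by ring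
      _ = numN D₂ D₃ D * (structConst D₁ D E * (nR D₁ * nR D)) := by
        rw [structConst_spec]; ring
      _ = _ := by rw [structConst_spec]; ring
  rw [hL, hR]
  congr 1
  induction D₁ using DC.ind with
  | h α =>
  induction D₂ using DC.ind with
  | h β =>
  induction D₃ using DC.ind with
  | h γ =>
  have key : ∀ (α β : S.Elt) (a b : Comp r n) (E : DC S a b) (c : Comp r n),
      numN (dc S a c α) (dc S c b β) E =
        ∑ ρ : young c, if dc S a b (α * S.perm ρ * β) = E then 1 else 0 := by
    intro α β a b E c
    rw [numN_dc, Nat.card_eq_fintype_card, Fintype.card_subtype, Finset.card_filter]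
  rw [sum_numN, sum_numN]
  simp only [key]
  rw [Finset.sum_comm]
  simp only [mul_assoc]

theorem one_structConst {l m : Comp r n} (D D' : DC S l m) :
    structConst (dc S l l 1) D D' = if D = D' then 1 else 0 := by
  classical
  induction D using DC.ind with
  | h β =>
  have h1 : nR (dc S l l 1) = Nat.card (young l) := by
    rw [nR_dc]
    congr 2
    ext σ
    exact ⟨fun h => h.1, fun h => ⟨h, σ, h, by simp⟩⟩
  have h2 : numN (dc S l l 1) (dc S l m β) D' =
      if dc S l m β = D' then Nat.card (young l) else 0 := by
    rw [numN_dc]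
    simp only [one_mul, dc_mul_left β (Subtype.property _)]
    split_ifs with h
    · simp [h]
    · simp [h]
  rw [structConst, h1, h2]
  have hp : 0 < Nat.card (young l) := Nat.card_pos
  split_ifs with h
  · rw [← h, mul_comm]
    exact Nat.div_self (Nat.mul_pos hp (nR_pos _))
  · simp

theorem structConst_one {l m : Comp r n} (D D' : DC S l m) :
    structConst D (dc S m m 1) D' = if D = D' then 1 else 0 := by
  classical
  induction D using DC.ind with
  | h β =>
  have h1 : nR (dc S m m 1) = Nat.card (young m) := by
    rw [nR_dc]
    congr 2
    ext σ
    exact ⟨fun h => h.1, fun h => ⟨h, σ, h, by simp⟩⟩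
  have h2 : numN (dc S l m β) (dc S m m 1) D' =
      if dc S l m β = D' then Nat.card (young m) else 0 := by
    rw [numN_dc]
    simp only [mul_one, dc_mul_right β (Subtype.property _)]
    split_ifs with h
    · simp [h]
    · simp [h]
  rw [structConst, h1, h2]
  have hp : 0 < Nat.card (young m) := Nat.card_pos
  split_ifs with h
  · rw [← h]
    exact Nat.div_self (Nat.mul_pos (nR_pos _) hp)
  · simp

end DoubleCosets

/-! ## The right generalized Schur algebra -/

/-- The right generalized Schur algebra `B_R` over `k` of the monoid `S = S_r`: the free module
on the double cosets `D ∈ _λM_μ`, `λ, μ ∈ Λ(r,n)`. An element is the family of its coordinates. -/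
def RSchur (k : Type*) {r : ℕ} (S : TransMonoid r) (n : ℕ) : Type _ :=
  ∀ l m : Comp r n, DC S l m → k

namespace RSchur

@[ext] theorem ext {k : Type*} {r n : ℕ} {S : TransMonoid r} {x y : RSchur k S n}
    (h : ∀ l m D, x l m D = y l m D) : x = y :=
  funext fun l => funext fun m => funext fun D => h l m D

variable {k : Type*} [CommRing k] {r n : ℕ} {S : TransMonoid r}

instance : AddCommGroup (RSchur k S n) :=
  inferInstanceAs (AddCommGroup (∀ l m : Comp r n, DC S l m → k))

instance : Module k (RSchur k S n) :=
  inferInstanceAs (Module k (∀ l m : Comp r n, DC S l m → k))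

@[simp] theorem add_coord (x y : RSchur k S n) (l m : Comp r n) (D : DC S l m) :
    (x + y) l m D = x l m D + y l m D := rfl

@[simp] theorem zero_coord (l m : Comp r n) (D : DC S l m) : (0 : RSchur k S n) l m D = 0 := rfl

@[simp] theorem smul_coord (c : k) (x : RSchur k S n) (l m : Comp r n) (D : DC S l m) :
    (c • x) l m D = c * x l m D := rfl

/-- The basis element `f(λ,α,μ)` attached to the double coset of `α`. -/
noncomputable def f (k : Type*) [CommRing k] {r n : ℕ} (S : TransMonoid r) (l m : Comp r n)
    (α : S.Elt) : RSchur k S n :=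
  Pi.single l (Pi.single m (Pi.single (dc S l m α) 1))

/-- The product `*_R`, extended bilinearly from
`f(λ,D₁,ν) f(ν,D₂,μ) = ∑_D n_R(D) N(D₁,D₂,D) / (n_R(D₁) n_R(D₂)) f(λ,D,μ)`,
while `f(λ,D₁,ν) f(ω,D₂,μ) = 0` for `ν ≠ ω`. -/
noncomputable instance : Mul (RSchur k S n) where
  mul x y := fun l m D => ∑ v : Comp r n, ∑ D₁ : DC S l v, ∑ D₂ : DC S v m,
    x l v D₁ * y v m D₂ * (structConst D₁ D₂ D : k)

/-- The identity `∑_λ f(λ,1,λ)`. -/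
noncomputable instance : One (RSchur k S n) where
  one := ∑ l, f k S l l 1

theorem mul_coord (x y : RSchur k S n) (l m : Comp r n) (D : DC S l m) :
    (x * y) l m D = ∑ v : Comp r n, ∑ D₁ : DC S l v, ∑ D₂ : DC S v m,
      x l v D₁ * y v m D₂ * (structConst D₁ D₂ D : k) := rfl

theorem f_coord (l m : Comp r n) (α : S.Elt) (l' m' : Comp r n) (D : DC S l' m') :
    f k S l m α l' m' D = Pi.single (M := fun l => ∀ m, DC S l m → k) l
      (Pi.single m (Pi.single (dc S l m α) 1)) l' m' D := rfl

theorem sum_coord {ι : Type*} (s : Finset ι) (F : ι → RSchur k S n) (l m : Comp r n)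
    (D : DC S l m) : (∑ i ∈ s, F i) l m D = ∑ i ∈ s, F i l m D :=
  map_sum (⟨⟨fun x => x l m D, rfl⟩, fun _ _ => rfl⟩ : RSchur k S n →+ k) F s

theorem one_coord_same (l : Comp r n) (D : DC S l l) :
    (1 : RSchur k S n) l l D = if dc S l l 1 = D then 1 else 0 := by
  change (∑ l', f k S l' l' 1 : RSchur k S n) l l D = _
  rw [sum_coord, Finset.sum_eq_single l]
  · simp only [f, Pi.single_eq_same, Pi.single_apply]
    exact if_congr eq_comm rfl rfl
  · intro b _ hb
    simp only [f]
    rw [Pi.single_eq_of_ne (Ne.symm hb)]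
    rfl
  · simp

theorem one_coord_ne {l m : Comp r n} (h : l ≠ m) (D : DC S l m) :
    (1 : RSchur k S n) l m D = 0 := by
  change (∑ l', f k S l' l' 1 : RSchur k S n) l m D = _
  rw [sum_coord]
  refine Finset.sum_eq_zero fun b _ => ?_
  simp only [f]
  by_cases hb : l = b
  · subst hb
    rw [Pi.single_eq_same, Pi.single_eq_of_ne (Ne.symm h)]
    rfl
  · rw [Pi.single_eq_of_ne hb]
    rfl

theorem sum_rot {A B C : Type*} [Fintype A] [Fintype B] [Fintype C] (F : A → B → C → k) :
    ∑ a, ∑ b, ∑ c, F a b c = ∑ c, ∑ a, ∑ b, F a b c := by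
  calc ∑ a, ∑ b, ∑ c, F a b c = ∑ a, ∑ c, ∑ b, F a b c :=
        Finset.sum_congr rfl fun a _ => Finset.sum_comm
    _ = ∑ c, ∑ a, ∑ b, F a b c := Finset.sum_comm

protected theorem mul_assoc' (x y z : RSchur k S n) : x * y * z = x * (y * z) := by
  ext l m E
  have hL : (x * y * z) l m E = ∑ w : Comp r n, ∑ v : Comp r n, ∑ D₁ : DC S l v,
      ∑ D₂ : DC S v w, ∑ D₃ : DC S w m, x l v D₁ * y v w D₂ * z w m D₃ *
        ((∑ D, structConst D₁ D₂ D * structConst D D₃ E : ℕ) : k) := by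
    rw [mul_coord]
    refine Finset.sum_congr rfl fun w _ => ?_
    simp only [mul_coord, Finset.sum_mul, Nat.cast_sum, Finset.mul_sum]
    rw [sum_rot]
    refine Finset.sum_congr rfl fun v _ => ?_
    rw [sum_rot]
    refine Finset.sum_congr rfl fun D₁ _ => ?_
    rw [sum_rot]
    refine Finset.sum_congr rfl fun D₂ _ => ?_
    rw [Finset.sum_comm]
    refine Finset.sum_congr rfl fun D₃ _ => Finset.sum_congr rfl fun D _ => ?_
    push_cast
    ring
  have hR : (x * (y * z)) l m E = ∑ w : Comp r n, ∑ v : Comp r n, ∑ D₁ : DC S l v,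
      ∑ D₂ : DC S v w, ∑ D₃ : DC S w m, x l v D₁ * y v w D₂ * z w m D₃ *
        ((∑ D, structConst D₂ D₃ D * structConst D₁ D E : ℕ) : k) := by
    rw [mul_coord, Finset.sum_comm]
    refine Finset.sum_congr rfl fun v _ => ?_
    simp only [mul_coord, Finset.sum_mul, Nat.cast_sum, Finset.mul_sum]
    refine Eq.trans (Finset.sum_congr rfl fun D₁ _ => ?_) Finset.sum_comm
    rw [Finset.sum_comm]
    refine Finset.sum_congr rfl fun w _ => ?_
    rw [Finset.sum_comm]
    refine Finset.sum_congr rfl fun D₂ _ => ?_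
    rw [Finset.sum_comm]
    refine Finset.sum_congr rfl fun D₃ _ => Finset.sum_congr rfl fun D _ => ?_
    push_cast
    ring
  rw [hL, hR]
  simp only [structConst_assoc]

protected theorem one_mul' (x : RSchur k S n) : 1 * x = x := by
  ext l m D
  rw [mul_coord, Finset.sum_eq_single l]
  · simp only [one_coord_same, ite_mul, one_mul, zero_mul]
    rw [Finset.sum_comm]
    simp [one_structConst]
  · intro b _ hb
    simp [one_coord_ne (Ne.symm hb)]
  · simp

protected theorem mul_one' (x : RSchur k S n) : x * 1 = x := by
  ext l m D
  rw [mul_coord, Finset.sum_eq_single m]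
  · simp [one_coord_same, structConst_one]
  · intro b _ hb
    simp [one_coord_ne hb]
  · simp

noncomputable instance : Ring (RSchur k S n) :=
  { (inferInstance : AddCommGroup (RSchur k S n)),
    (inferInstance : Mul (RSchur k S n)),
    (inferInstance : One (RSchur k S n)) with
    left_distrib := fun x y z => by
      ext l m D
      simp only [mul_coord, add_coord, mul_add, add_mul, Finset.sum_add_distrib]
    right_distrib := fun x y z => by
      ext l m D
      simp only [mul_coord, add_coord, add_mul, Finset.sum_add_distrib]
    zero_mul := fun x => by
      ext l m D
      simp [mul_coord]
    mul_zero := fun x => by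
      ext l m D
      simp [mul_coord]
    mul_assoc := RSchur.mul_assoc'
    one_mul := RSchur.one_mul'
    mul_one := RSchur.mul_one' }

noncomputable instance : Algebra k (RSchur k S n) :=
  Algebra.ofModule
    (fun c x y => by
      ext l m D
      simp only [mul_coord, smul_coord, Finset.mul_sum, mul_assoc])
    (fun c x y => by
      ext l m D
      simp only [mul_coord, smul_coord, Finset.mul_sum]
      refine Finset.sum_congr rfl fun _ _ => Finset.sum_congr rfl fun _ _ =>
        Finset.sum_congr rfl fun _ _ => ?_
      ring)

theorem f_mul_coord_same (x : RSchur k S n) (l m : Comp r n) (D : DC S l m) :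
    (f k S l l 1 * x) l m D = x l m D := by
  rw [mul_coord, Finset.sum_eq_single l]
  · simp only [f, Pi.single_eq_same, Pi.single_apply, ite_mul, one_mul, zero_mul]
    rw [Finset.sum_comm]
    simp [one_structConst]
  · intro b _ hb
    simp [f, Pi.single_eq_of_ne hb]
  · simp

theorem f_mul_coord_ne (x : RSchur k S n) {l a : Comp r n} (h : a ≠ l) (m : Comp r n)
    (D : DC S a m) : (f k S l l 1 * x) a m D = 0 := by
  rw [mul_coord]
  simp [f, Pi.single_eq_of_ne h]

theorem mul_f_coord_same (x : RSchur k S n) (l m : Comp r n) (D : DC S l m) :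
    (x * f k S m m 1) l m D = x l m D := by
  rw [mul_coord, Finset.sum_eq_single m]
  · simp [f, Pi.single_apply, structConst_one]
  · intro b _ hb
    simp [f, Pi.single_eq_of_ne hb]
  · simp

theorem mul_f_coord_ne (x : RSchur k S n) {m b : Comp r n} (h : b ≠ m) (l : Comp r n)
    (D : DC S l b) : (x * f k S m m 1) l b D = 0 := by
  rw [mul_coord]
  refine Finset.sum_eq_zero fun v _ => Finset.sum_eq_zero fun D₁ _ =>
    Finset.sum_eq_zero fun D₂ _ => ?_
  by_cases hv : v = m
  · subst hv
    simp [f, Pi.single_eq_of_ne h]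
  · simp [f, Pi.single_eq_of_ne hv]

theorem one_mul_f (l m : Comp r n) (α : S.Elt) : f k S l l 1 * f k S l m α = f k S l m α := by
  ext a b D
  by_cases h : a = l
  · subst h
    rw [f_mul_coord_same]
  · rw [f_mul_coord_ne _ h]
    simp [f, Pi.single_eq_of_ne h]

theorem f_mul_one (l m : Comp r n) (α : S.Elt) : f k S l m α * f k S m m 1 = f k S l m α := by
  ext a b D
  by_cases h : b = m
  · subst h
    rw [mul_f_coord_same]
  · rw [mul_f_coord_ne _ h]
    by_cases ha : a = l
    · subst ha
      simp [f, Pi.single_eq_of_ne h]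
    · simp [f, Pi.single_eq_of_ne ha]

end RSchur

/-! ## The algebras `B_R^λ` and `C_R^λ` -/

section Corner

variable {k A : Type*} [CommRing k] [Ring A] [Algebra k A] {e : A}

theorem smul_mem_corner (c : k) {x : A} (hx : x ∈ Subsemigroup.corner e) :
    c • x ∈ Subsemigroup.corner e := by
  obtain ⟨y, rfl⟩ := hx
  exact ⟨c • y, by simp⟩

instance cornerModule (he : IsIdempotentElem e) : Module k he.Corner where
  smul c x := ⟨c • x.1, smul_mem_corner c x.2⟩
  one_smul x := Subtype.ext (one_smul k x.1)
  mul_smul c d x := Subtype.ext (mul_smul c d x.1)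
  smul_zero c := Subtype.ext (smul_zero c)
  smul_add c x y := Subtype.ext (smul_add c x.1 y.1)
  add_smul c d x := Subtype.ext (add_smul c d x.1)
  zero_smul x := Subtype.ext (zero_smul k x.1)

/-- The `k`-algebra structure on `e A e`, with unit `e`. -/
instance cornerAlgebra (he : IsIdempotentElem e) : Algebra k he.Corner :=
  Algebra.ofModule (fun c x y => Subtype.ext (smul_mul_assoc c x.1 y.1))
    (fun c x y => Subtype.ext (mul_smul_comm c x.1 y.1))

end Corner

section Quotients

variable (k : Type*) [CommRing k] {r n : ℕ} (S : TransMonoid r) (l : Comp r n)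

theorem isIdempotentElem_f : IsIdempotentElem (RSchur.f k S l l 1) := RSchur.one_mul_f l l 1

/-- `B_R^λ = 1_λ B_R 1_λ`, a `k`-algebra with unit `1_λ = f(λ,1,λ)`. -/
abbrev BCorner : Type _ := (isIdempotentElem_f k S l).Corner

open Classical in
/-- `e_λ = ∑_{ν < λ} 1_ν`. -/
noncomputable def eLT : RSchur k S n :=
  ∑ v ∈ Finset.univ.filter (fun v : Comp r n => compLT v l), RSchur.f k S v v 1

/-- `B_R e_λ B_R ∩ B_R^λ`, an ideal of `B_R^λ`; here `B_R e_λ B_R` is the two-sided ideal of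
`B_R` generated by `e_λ`. -/
noncomputable def kerIdeal : Ideal (BCorner k S l) where
  carrier := {x | (x.1 : RSchur k S n) ∈ TwoSidedIdeal.span {eLT k S l}}
  add_mem' := fun hx hy => TwoSidedIdeal.add_mem (TwoSidedIdeal.span {eLT k S l}) hx hy
  zero_mem' := TwoSidedIdeal.zero_mem (TwoSidedIdeal.span {eLT k S l})
  smul_mem' := fun c x hx =>
    TwoSidedIdeal.mul_mem_left (TwoSidedIdeal.span {eLT k S l}) c.1 x.1 hx

theorem mem_kerIdeal {x : BCorner k S l} :
    x ∈ kerIdeal k S l ↔ (x.1 : RSchur k S n) ∈ TwoSidedIdeal.span {eLT k S l} := Iff.rfl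

instance : (kerIdeal k S l).IsTwoSided where
  mul_mem_of_left := fun {a} b hx => by
    rw [mem_kerIdeal] at hx ⊢
    exact TwoSidedIdeal.mul_mem_right (TwoSidedIdeal.span {eLT k S l}) a.1 b.1 hx

/-- `C_R^λ = B_R^λ / (B_R e_λ B_R ∩ B_R^λ)`. -/
abbrev CR : Type _ := BCorner k S l ⧸ kerIdeal k S l

/-- The natural projection `Π_R : B_R^λ → C_R^λ`. -/
noncomputable def projR : BCorner k S l →ₐ[k] CR k S l := Ideal.Quotient.mkₐ k (kerIdeal k S l)

/-- `f(λ,α,λ)` as an element of `B_R^λ = 1_λ B_R 1_λ`. -/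
noncomputable def fCorner (α : S.Elt) : BCorner k S l :=
  ⟨RSchur.f k S l l α, RSchur.f k S l l α, by
    change RSchur.f k S l l 1 * RSchur.f k S l l α * RSchur.f k S l l 1 = _
    rw [RSchur.one_mul_f, RSchur.f_mul_one]⟩

end Quotients

/-! ## `p`-partitions and the map `φ_λ` -/

section PPartition

variable {r n : ℕ} (p : ℕ)

/-- A `p`-partition: every part is `0` or a power of `p`. -/
def IsPPartition (l : Comp r n) : Prop :=
  IsPartition l ∧ ∀ i, l.1 i = 0 ∨ ∃ t, l.1 i = p ^ t

/-- `s_i`: the number of rows of length `p ^ i`. -/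
def mult (l : Comp r n) (i : ℕ) : ℕ := numRows l (p ^ i)

/-- The `a`-th row (from the top, `a` starting at `0`) among the rows of length `p ^ i`. -/
def nthRow (l : Comp r n) (i : ℕ) (a : Fin (mult p l i)) :
    {j // j ∈ Finset.univ.filter fun j => l.1 j = p ^ i} :=
  Finset.orderIsoOfFin _ rfl a

theorem nthRow_len (l : Comp r n) (i : ℕ) (a : Fin (mult p l i)) :
    l.1 (nthRow p l i a) = p ^ i :=
  (Finset.mem_filter.1 (nthRow p l i a).2).2

/-- `(i, a, b)` is sent to the `b`-th entry of the `a`-th row of length `p ^ i`. -/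
def labelFun (l : Comp r n) (y : Σ i : ℕ, Fin (mult p l i) × Fin (p ^ i)) : Fin r :=
  cell l ⟨nthRow p l y.1 y.2.1, Fin.cast (nthRow_len p l y.1 y.2.1).symm y.2.2⟩

variable {p}

theorem labelFun_bijective [hp : Fact p.Prime] {l : Comp r n} (hl : IsPPartition p l) :
    Function.Bijective (labelFun p l) := by
  constructor
  · rintro ⟨i, a, b⟩ ⟨i', a', b'⟩ h
    have h1 := (cell l).injective h
    obtain ⟨h2, h3⟩ := Sigma.mk.inj_iff.1 h1
    have hi : i = i' := by
      have e := nthRow_len p l i a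
      rw [show ((nthRow p l i a : Fin n)) = nthRow p l i' a' from h2, nthRow_len] at e
      exact (Nat.pow_right_injective hp.out.two_le e).symm
    subst hi
    have ha : a = a' := (Finset.orderIsoOfFin _ rfl).injective (Subtype.ext h2)
    subst ha
    have hb : b = b' := by
      have := eq_of_heq h3
      exact Fin.ext (by simpa using congrArg Fin.val this)
    rw [hb]
  · intro x
    obtain ⟨⟨j, b⟩, rfl⟩ := (cell l).surjective x
    obtain ⟨i, hi⟩ : ∃ i, l.1 j = p ^ i := by
      rcases hl.2 j with h | h
      · exact absurd b.2 (by omega)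
      · exact h
    obtain ⟨a, ha⟩ := (Finset.orderIsoOfFin
      (Finset.univ.filter fun j => l.1 j = p ^ i) rfl).surjective ⟨j, by simp [hi]⟩
    have hj : (nthRow p l i a : Fin n) = j := congrArg Subtype.val ha
    refine ⟨⟨i, a, Fin.cast hi b⟩, ?_⟩
    refine congrArg (cell l) (Sigma.ext hj ?_)
    exact (Fin.heq_ext_iff ((nthRow_len p l i a).trans hi.symm)).2 rfl

/-- The bijection between the triples `(i, a, b)` and the entries of the tableau: `(i, a, b)` is
the `b`-th entry of the `a`-th row of length `p ^ i`. -/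
noncomputable def label [Fact p.Prime] {l : Comp r n} (hl : IsPPartition p l) :
    (Σ i : ℕ, Fin (mult p l i) × Fin (p ^ i)) ≃ Fin r :=
  Equiv.ofBijective (labelFun p l) (labelFun_bijective hl)

/-- The homomorphism `φ_λ : ∏_i τ̄_{s_i} → τ̄_r` (the factors with `s_i = 0` are trivial):
`φ_λ(α)` maps the `b`-th entry of the `a`-th row of length `p ^ i` to the `b`-th entry of the
`α_i(a)`-th row of length `p ^ i`, or to `0` if `α_i(a) = 0`. -/
noncomputable def phi [Fact p.Prime] {l : Comp r n} (hl : IsPPartition p l) :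
    (∀ i : ℕ, PT (mult p l i)) →* PT r where
  toFun α := PT.mk fun x =>
    let y := (label hl).symm x
    Fin.cases (motive := fun _ => Fin (r + 1)) 0
      (fun a' => (label hl ⟨y.1, a', y.2.2⟩).succ) ((α y.1).app y.2.1.succ)
  map_one' := by
    refine PT.ext fun x => ?_
    refine Fin.cases (by simp) (fun x => ?_) x
    simp
  map_mul' α β := by
    refine PT.ext fun x => ?_
    refine Fin.cases (by simp) (fun x => ?_) x
    rw [PT.mul_app, PT.mk_app_succ, PT.mk_app_succ]
    simp only [Pi.mul_apply, PT.mul_app]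
    generalize (β ((label hl).symm x).1).app ((label hl).symm x).2.1.succ = c
    refine Fin.cases ?_ (fun a' => ?_) c
    · simp
    · simp only [Fin.cases_succ, PT.mk_app_succ]
      rw [Equiv.symm_apply_apply]

/-- The submonoid `S₀ · ∏_{i>0} 𝔖_{s_i}` of `∏_i τ̄_{s_i}`. -/
def prodSub (l : Comp r n) (S₀ : Submonoid (PT (mult p l 0))) :
    Submonoid (∀ i : ℕ, PT (mult p l i)) where
  carrier := {α | α 0 ∈ S₀ ∧ ∀ i, 0 < i → α i ∈ symSub (mult p l i)}
  one_mem' := ⟨one_mem _, fun _ _ => one_mem _⟩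
  mul_mem' := fun ha hb => ⟨mul_mem ha.1 hb.1, fun i hi => mul_mem (ha.2 i hi) (hb.2 i hi)⟩

variable [Fact p.Prime] {l : Comp r n} (hl : IsPPartition p l) (S : TransMonoid r)

/-- `S_r^λ = image(φ_λ) ∩ S_r`. -/
noncomputable def Slam : Submonoid (PT r) := MonoidHom.mrange (phi hl) ⊓ S.toSubmonoid

/-- `S' = φ_λ(τ̄_{s_0} · ∏_{i>0} 𝔖_{s_i}) ∩ S_r^λ`. -/
noncomputable def Sprime : Submonoid (PT r) :=
  (prodSub (p := p) l ⊤).map (phi hl) ⊓ Slam hl S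

theorem Sprime_le : Sprime hl S ≤ Slam hl S := inf_le_right

/-- The `k`-linear map `ψ_{λ,R} : k[S_r^λ] → B_R^λ`, `α ↦ f(λ,α,λ)`. -/
noncomputable def psi (k : Type*) [CommRing k] :
    MonoidAlgebra k (Slam hl S) →ₗ[k] BCorner k S l :=
  (Finsupp.linearCombination k fun α : Slam hl S => fCorner k S l ⟨α.1, α.2.2⟩) ∘ₗ
    (MonoidAlgebra.coeffLinearEquiv k).toLinearMap

/-- The inclusion `k[S'] → k[S_r^λ]`. -/
noncomputable def inclS (k : Type*) [CommRing k] :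
    MonoidAlgebra k (Sprime hl S) →ₐ[k] MonoidAlgebra k (Slam hl S) :=
  MonoidAlgebra.mapDomainAlgHom k k (Submonoid.inclusion (Sprime_le hl S))

end PPartition

end GenSchur

/-! Call `α` stable if every `σ ∈ G_λ` satisfies `σα = απ` for some `π ∈ G_μ`. Then `n_R` takes its
largest value `|G_λ|`, and a product of basis elements whose right factor is stable collapses to one
basis element once the values of `n_R` match (`f_mul_f_of_isStable`). Elements in the image of `φ_λ`
are stable, since they send each row to `0` or bijectively onto a row. So `f(λ,α,λ)` is
multiplicative on `S'` already in `B_R^λ`, and what remains is to see that its image in `C_R^λ` is a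
basis.

Linear independence. Distinct elements of `S'` lie in distinct double cosets (`phi_eq_of_dc_eq`), so
it suffices that the coordinates of `B_R e_λ B_R` at these cosets vanish, that is, that `p` divides
every structure constant leading through some `ν < λ` to the coset of `γ ∈ S'`
(`prime_dvd_structConst`). For stable `γ` such a constant is a multiple of the index of `G_R(λ,α,ν)`
in `G_λ`. The simultaneous rotation of all rows has `p`-power order because `λ` is a `p`-partition;
if `p` did not divide the index, a conjugate of it would lie in `G_R(λ,α,ν)`. The orbits of the
rotation are the rows of `λ`, and those of length greater than one would then lift injectively into
blocks of `ν`, contradicting `ν < λ`.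

Spanning. Suppose `f(λ,α,λ) ∉ B_R e_λ B_R`. A strict refinement of the rows of `λ` compatible with
`α` would factor `f(λ,α,λ)` through a smaller composition; this is where `r ≤ n` enters. Suitable
refinements show that `α` is stable, injective on each row, and sends each row to `0` or onto a row.
If `α` missed a row of length greater than one, it would absorb on the left the rook idempotent
killing that row, whose basis element lies in the ideal. Hence `α` agrees with an element of `S'` up
to a factor in `G_λ` (`projR_fCorner_mem_range`).

For the factorization of `S'`, the components in `𝔖_{s_i}`, `i > 0`, give invertible elements of
`ℜ_r ⊆ S_r` and can be split off. Monoid algebras turn products into tensor products. -/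

open scoped TensorProduct

namespace GenSchur

/-! ### Monoid algebras of finite products as tensor products -/

section MonoidAlgebras

/-- The monoid elements as a basis of the monoid algebra. -/
noncomputable def monoidBasis (k M : Type*) [Field k] : Module.Basis M k (MonoidAlgebra k M) :=
  ⟨MonoidAlgebra.coeffLinearEquiv k⟩

theorem monoidBasis_apply (k M : Type*) [Field k] (m : M) :
    monoidBasis k M m = MonoidAlgebra.single m 1 := by
  rfl

/-- An algebra map from `k[M]` that carries the basis `M` to a basis is bijective; both tensor
decompositions below are instances. -/
theorem lift_bijective_of_basis {k M A : Type*} [Field k] [Monoid M] [Ring A] [Algebra k A]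
    (F : M →* A) (b : Module.Basis M k A) (h : ∀ m, b m = F m) :
    Function.Bijective (MonoidAlgebra.lift k A M F) := by
  have e : (MonoidAlgebra.lift k A M F).toLinearMap =
      ((monoidBasis k M).equiv b (Equiv.refl M)).toLinearMap := by
    refine (monoidBasis k M).ext fun m => ?_
    rw [LinearEquiv.coe_coe, Module.Basis.equiv_apply, monoidBasis_apply]
    simp [h]
  have := ((monoidBasis k M).equiv b (Equiv.refl M)).bijective
  rw [← LinearEquiv.coe_coe, ← e] at this
  exact this

/-- `k[M × N] ≅ k[M] ⊗ k[N]`. -/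
noncomputable def prodAlgEquiv (k M N : Type*) [Field k] [Monoid M] [Monoid N] :
    MonoidAlgebra k (M × N) ≃ₐ[k] MonoidAlgebra k M ⊗[k] MonoidAlgebra k N :=
  AlgEquiv.ofBijective
    (MonoidAlgebra.lift k _ (M × N)
      { toFun := fun x => MonoidAlgebra.single x.1 1 ⊗ₜ MonoidAlgebra.single x.2 1
        map_one' := rfl
        map_mul' := fun x y => by simp [MonoidAlgebra.single_mul_single] })
    (lift_bijective_of_basis _ ((monoidBasis k M).tensorProduct (monoidBasis k N)) fun m => by
      rw [Module.Basis.tensorProduct_apply']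
      rfl)

/-- `k[∏ Mᵢ] ≅ ⨂ k[Mᵢ]` for finite products. -/
noncomputable def piAlgEquiv (k : Type*) {ι : Type*} [Finite ι] (M : ι → Type*) [Field k]
    [∀ i, Monoid (M i)] :
    MonoidAlgebra k (∀ i, M i) ≃ₐ[k] ⨂[k] i, MonoidAlgebra k (M i) :=
  AlgEquiv.ofBijective
    (MonoidAlgebra.lift k _ (∀ i, M i)
      { toFun := fun x => PiTensorProduct.tprod k fun i => MonoidAlgebra.single (x i) 1
        map_one' := rfl
        map_mul' := fun x y => by
          rw [PiTensorProduct.tprod_mul_tprod]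
          congr 1
          funext i
          simp [MonoidAlgebra.single_mul_single] })
    (lift_bijective_of_basis _ (Basis.piTensorProduct fun i => monoidBasis k (M i)) fun m => by
      rw [Basis.piTensorProduct_apply]
      rfl)

end MonoidAlgebras

/-! ### A numerical form of the order on compositions -/

section Weights

theorem exists_perm_comp_eq {X T : Type*} [Finite X] (F G : X → T)
    (h : ∀ t, Nat.card {x // F x = t} = Nat.card {x // G x = t}) :
    ∃ π : Equiv.Perm X, ∀ x, G (π x) = F x :=
  ⟨Equiv.ofFiberEquiv fun t => (Finite.card_eq.1 (h t)).some, fun x => Equiv.ofFiberEquiv_map _ x⟩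

theorem card_fiber_eq_of_perm {X T : Type*} {F G : X → T} (π : Equiv.Perm X)
    (h : ∀ x, G (π x) = F x) (t : T) :
    Nat.card {x // F x = t} = Nat.card {x // G x = t} :=
  Nat.card_congr (π.subtypeEquiv fun x => by rw [h])

variable {r n : ℕ}

theorem card_row (l : Comp r n) (j : Fin n) : Nat.card {x : Fin r // row l x = j} = l.1 j := by
  have e : {x : Fin r // row l x = j} ≃ {y : Σ j : Fin n, Fin (l.1 j) // y.1 = j} :=
    (cell l).symm.subtypeEquiv fun x => Iff.rfl
  rw [Nat.card_congr (e.trans (Equiv.sigmaSubtype j)), Nat.card_eq_fintype_card, Fintype.card_fin]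

theorem row_cell (l : Comp r n) (y : Σ j : Fin n, Fin (l.1 j)) : row l (cell l y) = y.1 := by
  rw [row, Equiv.symm_apply_apply]

/-- A weight which detects the lexicographic order. -/
def weight (l : Comp r n) : ℕ := ∑ x, (r + 1) ^ l.1 (row l x)

theorem weight_eq (l : Comp r n) : weight l = ∑ j, l.1 j * (r + 1) ^ l.1 j := by
  rw [weight, ← (cell l).sum_comp, Fintype.sum_sigma]
  refine Finset.sum_congr rfl fun j _ => ?_
  refine (Finset.sum_congr (g := fun _ => (r + 1) ^ l.1 j) rfl fun b _ =>
    congrArg (fun t => (r + 1) ^ l.1 t) (row_cell l ⟨j, b⟩)).trans ?_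
  rw [Finset.sum_const, Finset.card_univ, Fintype.card_fin, smul_eq_mul]

theorem numRows_eq (l : Comp r n) (k : ℕ) : numRows l k = Nat.card {j // l.1 j = k} := by
  rw [numRows, Nat.card_eq_fintype_card, Fintype.card_subtype]

theorem Equi.weight_eq {l m : Comp r n} (h : Equi l m) : weight l = weight m := by
  obtain ⟨π, hπ⟩ := exists_perm_comp_eq l.1 m.1 fun t => by
    rw [← numRows_eq, ← numRows_eq, h t]
  rw [GenSchur.weight_eq, GenSchur.weight_eq]
  exact Fintype.sum_equiv π _ _ fun j =>
    congrArg (fun t => t * (r + 1) ^ t) (hπ j).symm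

theorem exists_partition (v : Comp r n) : ∃ v' : Comp r n, IsPartition v' ∧ Equi v v' := by
  let e : Equiv.Perm (Fin n) := Fin.revPerm.trans (Tuple.sort v.1)
  refine ⟨⟨fun i => v.1 (e i), (Equiv.sum_comp e v.1).trans v.2⟩, ?_, fun k => ?_⟩
  · exact (Tuple.monotone_sort v.1).comp_antitone Fin.rev_anti
  · refine (numRows_eq v k).trans (Eq.trans ?_ (numRows_eq _ k).symm)
    exact (card_fiber_eq_of_perm (F := fun i => v.1 (e i)) e (fun _ => rfl) k).symm

/-- At the first difference `k`, all remaining parts of `v` are at most `v_k` and have total at most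
`r`, so they contribute at most `r (r+1)^{v_k}`. This is less than `(r+1)^{v_k+1}`, which the part
`l_k` alone already contributes. The base `r + 1` is chosen for this comparison. -/
theorem lexLT.weight_lt {v l : Comp r n} (hv : IsPartition v) (h : lexLT v l) :
    weight v < weight l := by
  obtain ⟨k, hk, hlt⟩ := h
  rw [weight_eq, weight_eq, ← Finset.sum_filter_add_sum_filter_not Finset.univ (· < k),
    ← Finset.sum_filter_add_sum_filter_not Finset.univ (· < k)
      (fun j => l.1 j * (r + 1) ^ l.1 j)]
  refine add_lt_add_of_le_of_lt (Finset.sum_le_sum fun j hj => ?_) ?_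
  · rw [hk j (Finset.mem_filter.1 hj).2]
  calc ∑ j with ¬ j < k, v.1 j * (r + 1) ^ v.1 j
      ≤ ∑ j with ¬ j < k, v.1 j * (r + 1) ^ v.1 k := by
        refine Finset.sum_le_sum fun j hj => Nat.mul_le_mul_left _ ?_
        exact Nat.pow_le_pow_right (by omega) (hv (not_lt.1 (Finset.mem_filter.1 hj).2))
    _ ≤ r * (r + 1) ^ v.1 k := by
        rw [← Finset.sum_mul]
        refine Nat.mul_le_mul_right _ ?_
        calc _ ≤ ∑ j, v.1 j := Finset.sum_le_sum_of_subset (Finset.filter_subset _ _)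
          _ = r := v.2
    _ < (r + 1) ^ (v.1 k + 1) := by
        rw [pow_succ, mul_comm]
        exact Nat.mul_lt_mul_of_pos_left (by omega) (by positivity)
    _ ≤ (r + 1) ^ l.1 k := Nat.pow_le_pow_right (by omega) hlt
    _ ≤ l.1 k * (r + 1) ^ l.1 k := Nat.le_mul_of_pos_left _ (by omega)
    _ ≤ _ := Finset.single_le_sum (f := fun j => l.1 j * (r + 1) ^ l.1 j)
        (fun _ _ => Nat.zero_le _) (by simp)

/-- The weight depends only on the multiset of parts, so rearranging into partitions is harmless.
The converse holds because the lexicographic order on partitions is total. -/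
theorem compLT_iff {v l : Comp r n} : compLT v l ↔ weight v < weight l := by
  constructor
  · rintro ⟨v', l', hv', ev, -, el, h⟩
    rw [ev.weight_eq, el.weight_eq]
    exact h.weight_lt hv'
  · intro h
    obtain ⟨v', hv', ev⟩ := exists_partition v
    obtain ⟨l', hl', el⟩ := exists_partition l
    refine ⟨v', l', hv', ev, hl', el, ?_⟩
    rw [ev.weight_eq, el.weight_eq] at h
    have hne : ∃ k, v'.1 k ≠ l'.1 k := by
      by_contra! hc
      rw [show v' = l' from Subtype.ext (funext hc)] at h
      exact lt_irrefl _ h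
    classical
    have hs : (Finset.univ.filter fun k => v'.1 k ≠ l'.1 k).Nonempty :=
      ⟨hne.choose, by simpa using hne.choose_spec⟩
    obtain ⟨k, hk, hmin⟩ := Finset.exists_minimal hs
    have hk' : v'.1 k ≠ l'.1 k := (Finset.mem_filter.1 hk).2
    have heq : ∀ i, i < k → v'.1 i = l'.1 i := fun i hi => by
      by_contra hc
      exact absurd (hmin (by simpa using hc) hi.le) (not_le.2 hi)
    rcases hk'.lt_or_gt with h1 | h1
    · exact ⟨k, heq, h1⟩
    · exact absurd h (lexLT.weight_lt hl' ⟨k, fun i hi => (heq i hi).symm, h1⟩).le.not_gt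

/-- As the weight is a sum over points, compositions can be compared through the lengths of the rows
of corresponding points, for any bijection of the points. -/
theorem weight_le_of_perm {l m : Comp r n} (θ : Equiv.Perm (Fin r))
    (h : ∀ x, l.1 (row l x) ≤ m.1 (row m (θ x))) : weight l ≤ weight m := by
  rw [weight, weight, ← Equiv.sum_comp θ (fun x => (r + 1) ^ m.1 (row m x))]
  exact Finset.sum_le_sum fun x _ => Nat.pow_le_pow_right (by omega) (h x)

theorem weight_lt_of_perm {l m : Comp r n} (θ : Equiv.Perm (Fin r))
    (h : ∀ x, l.1 (row l x) ≤ m.1 (row m (θ x)))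
    (h' : ∃ x, l.1 (row l x) < m.1 (row m (θ x))) : weight l < weight m := by
  rw [weight, weight, ← Equiv.sum_comp θ (fun x => (r + 1) ^ m.1 (row m x))]
  obtain ⟨x, hx⟩ := h'
  have : 0 < r := x.pos
  exact Finset.sum_lt_sum (fun x _ => Nat.pow_le_pow_right (by omega) (h x))
    ⟨x, Finset.mem_univ _, Nat.pow_lt_pow_right (by omega) hx⟩

theorem row_card_eq (l : Comp r n) (x : Fin r) :
    l.1 (row l x) = Nat.card {y : Fin r // row l y = row l x} := (card_row l _).symm

/-- Every colouring of `{1,…,r}` is, up to a permutation, the colouring by the blocks of a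
composition. -/
theorem exists_comp_of_coloring (hn : r ≤ n) {T : Type*} (c : Fin r → T) :
    ∃ (v : Comp r n) (τ : Equiv.Perm (Fin r)),
      ∀ x y, row v x = row v y ↔ c (τ x) = c (τ y) := by
  classical
  -- At most `r ≤ n` colours occur, so they can index blocks; the unused blocks are empty.
  have hcard : Fintype.card (Set.range c) ≤ Fintype.card (Fin n) := by
    refine (Fintype.card_range_le c).trans ?_
    simpa using hn
  obtain ⟨⟨ι, hι⟩⟩ := Function.Embedding.nonempty_of_card_le hcard
  let d : Fin r → Fin n := fun x => ι ⟨c x, x, rfl⟩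
  have hd : ∀ x y, d x = d y ↔ c x = c y := fun x y =>
    ⟨fun h => congrArg Subtype.val (hι h), fun h => congrArg ι (Subtype.ext h)⟩
  let v : Comp r n := ⟨fun j => Nat.card {x // d x = j}, by
    simp_rw [Nat.card_eq_fintype_card]
    rw [← Fintype.card_sigma, Fintype.card_congr (Equiv.sigmaFiberEquiv d), Fintype.card_fin]⟩
  obtain ⟨τ, hτ⟩ := exists_perm_comp_eq (row v) d fun t => card_row v t
  exact ⟨v, τ, fun x y => by rw [← hd, hτ, hτ]⟩

/-- A strict refinement of the row partition of `l` comes from a smaller composition. -/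
theorem compLT_of_refines {T : Type*} {c : Fin r → T} {l v : Comp r n} {τ : Equiv.Perm (Fin r)}
    (hv : ∀ x y, row v x = row v y ↔ c (τ x) = c (τ y))
    (hc : ∀ x y, c x = c y → row l x = row l y)
    (hs : ∃ x y, row l x = row l y ∧ c x ≠ c y) : compLT v l := by
  have key : ∀ x, v.1 (row v x) = Nat.card {y // c y = c (τ x)} := fun x => by
    rw [row_card_eq]
    exact Nat.card_congr (τ.subtypeEquiv fun y => hv y x)
  rw [compLT_iff]
  refine weight_lt_of_perm τ (fun x => ?_) ?_
  · rw [key, row_card_eq]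
    exact Nat.card_le_card_of_injective _
      (Subtype.impEmbedding _ _ fun y hy => hc y (τ x) hy).injective
  · classical
    obtain ⟨x, y, hxy, hne⟩ := hs
    refine ⟨τ.symm x, ?_⟩
    rw [key, row_card_eq, Equiv.apply_symm_apply]
    simp only [Nat.card_eq_fintype_card, Fintype.card_subtype]
    refine Finset.card_lt_card ⟨fun z hz => ?_, fun h => hne ?_⟩
    · simp only [Finset.mem_filter, Finset.mem_univ, true_and] at hz ⊢
      exact hc z x hz
    · exact (by simpa using h (show y ∈ _ by simpa using hxy.symm) : c y = c x).symm

end Weights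

/-! ### Stable elements, products of basis elements and the ideal generated by `e_λ` -/

section Stable

variable {r n : ℕ} {S : TransMonoid r}

@[simp] theorem permHom_app_succ (σ : Equiv.Perm (Fin r)) (x : Fin r) :
    (permHom r σ).app x.succ = (σ x).succ := rfl

theorem perm_mul_eq_iff {α β : S.Elt} {σ π : Equiv.Perm (Fin r)} :
    S.perm σ * α = β * S.perm π ↔
      ∀ x : Fin r, (permHom r σ).app (α.1.app x.succ) = β.1.app (π x).succ := by
  constructor
  · intro h x
    exact congrArg (fun a : S.Elt => a.1.app x.succ) h
  · intro h
    refine Subtype.ext (PT.ext fun x => Fin.cases ?_ (fun y => h y) x)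
    rw [PT.app_zero, PT.app_zero]

/-- Left multiplication by `G_λ` preserves the coset `α G_μ`. -/
def IsStable (l m : Comp r n) (α : S.Elt) : Prop :=
  ∀ σ ∈ young l, ∃ π ∈ young m, S.perm σ * α = α * S.perm π

theorem IsStable.nR_eq {l m : Comp r n} {α : S.Elt} (h : IsStable l m α) :
    nR (dc S l m α) = Nat.card (young l) := by
  rw [nR_dc]
  congr 2
  ext σ
  exact ⟨fun h => h.1, fun hσ => ⟨hσ, h σ hσ⟩⟩

theorem IsStable.mul {l v m : Comp r n} {α β : S.Elt} (h : IsStable l v α) (h' : IsStable v m β) :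
    IsStable l m (α * β) := by
  intro σ hσ
  obtain ⟨π, hπ, e⟩ := h σ hσ
  obtain ⟨ρ, hρ, e'⟩ := h' π hπ
  exact ⟨ρ, hρ, by rw [← mul_assoc, e, mul_assoc, e', mul_assoc]⟩

theorem IsStable.dc_mul {l v m : Comp r n} {β : S.Elt} (h : IsStable v m β) (α : S.Elt)
    {ρ : Equiv.Perm (Fin r)} (hρ : ρ ∈ young v) :
    dc S l m (α * S.perm ρ * β) = dc S l m (α * β) := by
  obtain ⟨π, hπ, e⟩ := h ρ hρ
  rw [mul_assoc, e, ← mul_assoc, dc_mul_right _ hπ]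

/-- Every `ρ ∈ G_ν` can be moved past `β`, so all `|G_ν|` of them put `αρβ` into the coset of `αβ`.
This number cancels against `n_R(β) = |G_ν|`, and `hn` cancels the rest. -/
theorem IsStable.structConst {l v m : Comp r n} {α β : S.Elt} (h : IsStable v m β)
    (hn : nR (dc S l m (α * β)) = nR (dc S l v α)) (D : DC S l m) :
    structConst (dc S l v α) (dc S v m β) D = if dc S l m (α * β) = D then 1 else 0 := by
  have h1 : numN (dc S l v α) (dc S v m β) D =
      if dc S l m (α * β) = D then Nat.card (young v) else 0 := by
    rw [numN_dc]
    simp only [h.dc_mul α (Subtype.property _)]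
    split_ifs with h
    · simp [h]
    · simp [h]
  rw [GenSchur.structConst, h1, h.nR_eq]
  split_ifs with h2
  · rw [← h2, hn]
    exact Nat.div_self (Nat.mul_pos (nR_pos _) Nat.card_pos)
  · simp

namespace RSchur

variable {k : Type*} [CommRing k]

theorem f_coord_same (l m : Comp r n) (α : S.Elt) (D : DC S l m) :
    f k S l m α l m D = if D = dc S l m α then 1 else 0 := by
  simp [f, Pi.single_apply]

theorem f_coord_left_ne {l a : Comp r n} (h : a ≠ l) (m b : Comp r n) (α : S.Elt)
    (D : DC S a b) : f k S l m α a b D = 0 := by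
  simp [f, Pi.single_eq_of_ne h]

theorem f_coord_right_ne {m b : Comp r n} (h : b ≠ m) (l a : Comp r n) (α : S.Elt)
    (D : DC S a b) : f k S l m α a b D = 0 := by
  by_cases ha : a = l
  · subst ha
    simp [f, Pi.single_eq_of_ne h]
  · exact f_coord_left_ne ha _ _ _ _

theorem f_mul_f_coord (l v m : Comp r n) (α β : S.Elt) (D : DC S l m) :
    (f k S l v α * f k S v m β) l m D = structConst (dc S l v α) (dc S v m β) D := by
  rw [mul_coord, Finset.sum_eq_single v]
  · simp [f_coord_same]
  · intro b _ hb
    simp [f_coord_right_ne hb]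
  · simp

theorem f_mul_f_of_isStable {l v m : Comp r n} {α β : S.Elt} (h : IsStable v m β)
    (hn : nR (dc S l m (α * β)) = nR (dc S l v α)) :
    f k S l v α * f k S v m β = f k S l m (α * β) := by
  ext a b D
  by_cases ha : a = l
  · by_cases hb : b = m
    · subst ha hb
      rw [f_mul_f_coord, h.structConst hn, f_coord_same]
      simp [eq_comm]
    · rw [f_coord_right_ne hb, mul_coord]
      simp [f_coord_right_ne hb]
  · rw [f_coord_left_ne ha, mul_coord]
    simp [f_coord_left_ne ha]

theorem f_mul_eLT {l v m : Comp r n} (h : compLT v l) (α : S.Elt) :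
    f k S m v α * eLT k S l = f k S m v α := by
  classical
  rw [eLT, Finset.mul_sum, Finset.sum_eq_single v]
  · exact f_mul_one _ _ _
  · intro u _ hu
    ext a b D
    by_cases hb : b = u
    · subst hb
      rw [mul_f_coord_same, f_coord_right_ne hu, zero_coord]
    · rw [mul_f_coord_ne _ hb, zero_coord]
  · intro hv
    exact absurd (by simpa using h) hv

/-- Insert `e_λ` between the factors: its summand `1_v` acts as the identity there. -/
theorem f_mul_f_mem_span {l v a b : Comp r n} (h : compLT v l) (α β : S.Elt) :
    f k S a v α * f k S v b β ∈ TwoSidedIdeal.span {eLT k S l} := by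
  rw [← f_mul_eLT h α]
  exact TwoSidedIdeal.mul_mem_right _ _ _
    (TwoSidedIdeal.mul_mem_left _ _ _ (TwoSidedIdeal.subset_span rfl))

theorem eLT_mul_coord (l : Comp r n) (z : RSchur k S n) (v m : Comp r n) (D : DC S v m)
    (h : ¬ compLT v l) : (eLT k S l * z) v m D = 0 := by
  classical
  rw [eLT, Finset.sum_mul, sum_coord]
  refine Finset.sum_eq_zero fun u hu => f_mul_coord_ne _ ?_ _ _
  rintro rfl
  exact h (by simpa using hu)

/-- The ideal is additively generated by products `y e_λ z`, and only intermediate compositions `v <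
l` contribute to these, each with a structure constant that is zero in `k`. -/
theorem coord_eq_zero_of_mem_span {p : ℕ} [CharP k p] {l a b : Comp r n} {D : DC S a b}
    (h : ∀ v, compLT v l → ∀ (D₁ : DC S a v) (D₂ : DC S v b), p ∣ structConst D₁ D₂ D)
    {x : RSchur k S n} (hx : x ∈ TwoSidedIdeal.span {eLT k S l}) : x a b D = 0 := by
  rw [TwoSidedIdeal.mem_span_iff_mem_addSubgroup_closure] at hx
  induction hx using AddSubgroup.closure_induction with
  | mem x hx =>
    obtain ⟨-, ⟨y, -, e, rfl, rfl⟩, z, -, rfl⟩ := hx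
    change (y * eLT k S l * z) a b D = 0
    rw [mul_assoc, mul_coord]
    refine Finset.sum_eq_zero fun v _ => Finset.sum_eq_zero fun D₁ _ =>
      Finset.sum_eq_zero fun D₂ _ => ?_
    by_cases hv : compLT v l
    · rw [(CharP.cast_eq_zero_iff k p _).2 (h v hv D₁ D₂), mul_zero]
    · rw [eLT_mul_coord l z v b D₂ hv, mul_zero, zero_mul]
  | zero => rfl
  | add x y _ _ hx hy => rw [add_coord, hx, hy, add_zero]
  | neg x _ hx =>
    have : (-x + x) a b D = 0 := by rw [neg_add_cancel, zero_coord]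
    rwa [add_coord, hx, add_zero] at this

end RSchur

end Stable

/-! ### Divisibility of structure constants by `p` -/

section Divisibility

variable {r n : ℕ} {S : TransMonoid r}

/-- The set of `ρ` counted by `numN` is a union of left cosets of `G_R(v,β,m)`: if `κβ = βπ`, then
`αρκβ = αρβπ`. -/
theorem nR_dvd_numN {l v m : Comp r n} (α β : S.Elt) (D : DC S l m) :
    nR (dc S v m β) ∣ numN (dc S l v α) (dc S v m β) D := by
  classical
  have key : numN (dc S l v α) (dc S v m β) D =
      ∑ ρ : young v, if dc S l m (α * S.perm ρ * β) = D then 1 else 0 := by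
    rw [numN_dc, Nat.card_eq_fintype_card, Fintype.card_subtype, Finset.card_filter]
  rw [key, nR_dc, ← nat_card_subgroupOf (GR_le v m β), ← mul_one (Nat.card _)]
  refine card_dvd_sum _ _ _ ?_ fun _ => one_dvd _
  rintro ρ κ ⟨-, π, hπ, e⟩
  have e' : S.perm (κ : Equiv.Perm (Fin r)) * β = β * S.perm π := e
  rw [Subgroup.coe_mul, map_mul, mul_assoc α, mul_assoc (S.perm _) _ β, e', ← mul_assoc,
    ← mul_assoc, dc_mul_right _ hπ, mul_assoc α]

/-- With `n_R(γ) = |G_λ|` and `N = n_R(β) t`, the structure constant equals `[G_λ : G_R(λ,α,ν)] t`.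
-/
theorem dvd_structConst {l v m : Comp r n} {α β γ : S.Elt} (hγ : IsStable l m γ) {p : ℕ}
    (hp : p ∣ ((GR l v α).subgroupOf (young l)).index) :
    p ∣ structConst (dc S l v α) (dc S v m β) (dc S l m γ) := by
  obtain ⟨t, ht⟩ := nR_dvd_numN (l := l) (v := v) α β (dc S l m γ)
  have hi := ((GR l v α).subgroupOf (young l)).card_mul_index
  rw [nat_card_subgroupOf (GR_le l v α), ← nR_dc] at hi
  have hs := structConst_spec (dc S l v α) (dc S v m β) (dc S l m γ)
  rw [hγ.nR_eq, ht, ← hi] at hs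
  have hpos : 0 < nR (dc S l v α) * nR (dc S v m β) := Nat.mul_pos (nR_pos _) (nR_pos _)
  have : structConst (dc S l v α) (dc S v m β) (dc S l m γ) =
      ((GR l v α).subgroupOf (young l)).index * t := by
    refine Nat.eq_of_mul_eq_mul_right hpos ?_
    rw [hs]
    ring
  rw [this]
  exact hp.mul_right _

/-- An element of `p`-power order which has no conjugate in `H` forces `p` to divide the
index of `H`. -/
theorem prime_dvd_index {G : Type*} [Group G] [Finite G] (H : Subgroup G) {p : ℕ}
    [Fact p.Prime] {g : G} {N : ℕ} (hg : g ^ p ^ N = 1) (h : ∀ s, s⁻¹ * g * s ∉ H) :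
    p ∣ H.index := by
  by_contra hp
  have hP : IsPGroup p (Subgroup.zpowers g) := by
    rw [IsPGroup.iff_orderOf]
    rintro ⟨x, m, rfl⟩
    obtain ⟨j, -, hj⟩ := (Nat.dvd_prime_pow Fact.out).1 (orderOf_dvd_of_pow_eq_one
      (show (⟨g ^ m, m, rfl⟩ : Subgroup.zpowers g) ^ p ^ N = 1 from Subtype.ext (by
        change (g ^ m) ^ p ^ N = 1
        rw [← zpow_natCast, zpow_comm, zpow_natCast, hg, one_zpow])))
    exact ⟨j, hj⟩
  -- The `p`-group generated by `g` fixes a point of `G ⧸ H` if `p` does not divide its size; a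
  -- fixed coset `sH` means `s⁻¹ g s ∈ H`.
  obtain ⟨x, hx⟩ := hP.nonempty_fixed_point_of_prime_not_dvd_card (G ⧸ H) hp
  obtain ⟨s, rfl⟩ := QuotientGroup.mk_surjective x
  have : ((g * s : G) : G ⧸ H) = s := hx ⟨g, Subgroup.mem_zpowers g⟩
  refine h s ?_
  rw [mul_assoc]
  exact QuotientGroup.eq.1 this.symm

/-- The map `γ` hits every element of a row of length greater than one. -/
def HitsLargeRows (l : Comp r n) (γ : PT r) : Prop :=
  ∀ x : Fin r, 1 < l.1 (row l x) → ∃ z, γ.app z = x.succ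

theorem row_len_pos (l : Comp r n) (x : Fin r) : 0 < l.1 (row l x) := by
  rw [row_card_eq]
  have : Nonempty {y : Fin r // row l y = row l x} := ⟨⟨x, rfl⟩⟩
  exact Nat.card_pos

/-- If `α z = x`, then `g ^ m x = α (ρ ^ m z)`. As `g` is transitive on the row of `x`, that row
lifts injectively into the `v`-block of `z`. Choosing preimages for all points in rows of length
greater than one and extending to a permutation compares the weights; points in rows of length one
need no condition. -/
theorem weight_le_of_commute {l v : Comp r n} {α : S.Elt} {g ρ : Equiv.Perm (Fin r)}
    (hg : ∀ x y, row l x = row l y → ∃ m : ℕ, (g ^ m) x = y) (hρ : ρ ∈ young v)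
    (h : S.perm g * α = α * S.perm ρ) (hα : HitsLargeRows l α.1) : weight l ≤ weight v := by
  classical
  have hpow : ∀ m : ℕ, S.perm (g ^ m) * α = α * S.perm (ρ ^ m) := by
    intro m
    induction m with
    | zero => simp
    | succ m ih => rw [pow_succ, map_mul, mul_assoc, h, ← mul_assoc, ih, mul_assoc, ← map_mul,
        ← pow_succ]
  have hα' : ∀ x : {x : Fin r // 1 < l.1 (row l x)}, ∃ z : Fin r, α.1.app z.succ = x.1.succ := by
    rintro ⟨x, hx⟩
    obtain ⟨z, hz⟩ := hα x hx
    rcases Fin.eq_zero_or_eq_succ z with rfl | ⟨z, rfl⟩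
    · rw [PT.app_zero] at hz
      exact absurd hz.symm (Fin.succ_ne_zero x)
    · exact ⟨z, hz⟩
  choose s hs using hα'
  have hinj : Function.Injective s := fun x y hxy =>
    Subtype.ext (Fin.succ_injective _ (by rw [← hs, ← hs, hxy]))
  let e : {x : Fin r // 1 < l.1 (row l x)} ≃ {y // y ∈ Set.range s} := Equiv.ofInjective s hinj
  refine weight_le_of_perm e.extendSubtype fun x => ?_
  by_cases hx : 1 < l.1 (row l x)
  · rw [e.extendSubtype_apply_of_mem x hx]
    change _ ≤ v.1 (row v (s ⟨x, hx⟩))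
    rw [row_card_eq, row_card_eq]
    have : ∀ z : {z : Fin r // row l z = row l x},
        ∃ y : {y : Fin r // row v y = row v (s ⟨x, hx⟩)}, α.1.app y.1.succ = z.1.succ := by
      rintro ⟨z, hz⟩
      obtain ⟨m, rfl⟩ := hg x z hz.symm
      refine ⟨⟨(ρ ^ m) (s ⟨x, hx⟩), pow_mem hρ m _⟩, ?_⟩
      rw [← perm_mul_eq_iff.1 (hpow m), hs, permHom_app_succ]
    choose t ht using this
    refine Nat.card_le_card_of_injective t fun a b hab => ?_
    exact Subtype.ext (Fin.succ_injective _ (by rw [← ht, ← ht, hab]))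
  · exact (not_lt.1 hx).trans (row_len_pos v _)

/-- A non-zero count gives `γ = sαρβt` with `s ∈ G_λ`, so the image of `γ` lies in that of `sα`.
Being hit on all large rows is insensitive to permutations within rows. -/
theorem hitsLargeRows_of_numN_ne_zero {l v : Comp r n} {α β γ : S.Elt}
    (hγ : HitsLargeRows l γ.1) (h : numN (dc S l v α) (dc S v l β) (dc S l l γ) ≠ 0)
    {σ : Equiv.Perm (Fin r)} (hσ : σ ∈ young l) : HitsLargeRows l (S.perm σ * α).1 := by
  rw [numN_dc] at h
  obtain ⟨⟨⟨ρ, hρ⟩, e⟩⟩ := (Nat.card_ne_zero.1 h).1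
  obtain ⟨s, hs, t, ht, e'⟩ := dc_eq_iff.1 e
  intro x hx
  have h1 : row l (s (σ⁻¹ x)) = row l x := by
    rw [hs, (inv_mem hσ : σ⁻¹ ∈ young l) x]
  obtain ⟨z, hz⟩ := hγ (s (σ⁻¹ x)) (by rw [h1]; exact hx)
  rw [← e'] at hz
  let w := (permHom r ρ).app (β.1.app ((permHom r t).app z))
  have hz' : (permHom r s).app (α.1.app w) = (permHom r s).app (σ⁻¹ x).succ := hz
  have h2 : α.1.app w = (σ⁻¹ x).succ := by
    have := congrArg (permHom r s⁻¹).app hz'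
    simpa only [← PT.mul_app, ← map_mul, ← mul_assoc, inv_mul_cancel, map_one, one_mul,
      PT.one_app] using this
  refine ⟨w, ?_⟩
  change (permHom r σ).app (α.1.app w) = _
  rw [h2, permHom_app_succ]
  simp

theorem prime_dvd_structConst {l v : Comp r n} {p : ℕ} [Fact p.Prime]
    {g : Equiv.Perm (Fin r)} (hgl : g ∈ young l) {N : ℕ} (hgN : g ^ p ^ N = 1)
    (hg : ∀ x y, row l x = row l y → ∃ m : ℕ, (g ^ m) x = y) {γ : S.Elt}
    (hγs : IsStable l l γ) (hγ : HitsLargeRows l γ.1) (hv : compLT v l) (D₁ : DC S l v)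
    (D₂ : DC S v l) : p ∣ structConst D₁ D₂ (dc S l l γ) := by
  induction D₁ using DC.ind with
  | h α =>
  induction D₂ using DC.ind with
  | h β =>
  by_cases hN : numN (dc S l v α) (dc S v l β) (dc S l l γ) = 0
  · rw [structConst, hN, mul_zero, Nat.zero_div]
    exact dvd_zero _
  refine dvd_structConst hγs (prime_dvd_index _ (g := ⟨g, hgl⟩) (Subtype.ext hgN) ?_)
  rintro ⟨σ, hσ⟩ ⟨-, ρ, hρ, e⟩
  have e' : S.perm (σ⁻¹ * g * σ) * α = α * S.perm ρ := e
  -- A conjugate `σ⁻¹gσ` in `G_R(λ,α,ν)` amounts to `g(σα) = (σα)ρ`.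
  refine (compLT_iff.1 hv).not_ge (weight_le_of_commute hg hρ (α := S.perm σ * α) ?_
    (hitsLargeRows_of_numN_ne_zero hγ hN hσ))
  rw [mul_assoc, ← e', ← mul_assoc, ← mul_assoc, ← map_mul, ← map_mul, mul_assoc σ⁻¹,
    mul_inv_cancel_left]

end Divisibility

/-! ### The rotation of the rows, an element of `p`-power order -/

section Rotation

theorem finRotate_pow_self (m : ℕ) : finRotate m ^ m = 1 := by
  rcases lt_or_ge m 2 with h | h
  · have : Subsingleton (Fin m) := by
      rw [Fin.subsingleton_iff_le_one]
      omega
    exact Subsingleton.elim _ _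
  · have := (isCycle_finRotate_of_le h).orderOf
    rw [support_finRotate_of_le h, Finset.card_univ, Fintype.card_fin] at this
    exact orderOf_dvd_iff_pow_eq_one.1 this.dvd

theorem finRotate_transitive (m : ℕ) (a b : Fin m) : ∃ j : ℕ, (finRotate m ^ j) a = b := by
  rcases lt_or_ge m 2 with h | h
  · have : Subsingleton (Fin m) := by
      rw [Fin.subsingleton_iff_le_one]
      omega
    exact ⟨0, Subsingleton.elim _ _⟩
  · have hs : ∀ x, finRotate m x ≠ x := fun x => by
      rw [← Equiv.Perm.mem_support, support_finRotate_of_le h]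
      exact Finset.mem_univ x
    exact (isCycle_finRotate_of_le h).exists_pow_eq (hs a) (hs b)

variable {r n : ℕ}

/-- The simultaneous cyclic rotation of all rows. -/
def rotation (l : Comp r n) : Equiv.Perm (Fin r) :=
  (cell l).permCongr (Equiv.sigmaCongrRight fun j => finRotate (l.1 j))

theorem rotation_pow_cell (l : Comp r n) (m : ℕ) (y : Σ j : Fin n, Fin (l.1 j)) :
    (rotation l ^ m) (cell l y) = cell l ⟨y.1, (finRotate (l.1 y.1) ^ m) y.2⟩ := by
  induction m with
  | zero => rfl
  | succ m ih =>
    rw [pow_succ', Equiv.Perm.mul_apply, ih, pow_succ', rotation, Equiv.permCongr_apply,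
      Equiv.symm_apply_apply]
    rfl

theorem rotation_mem_young (l : Comp r n) : rotation l ∈ young l := by
  intro x
  obtain ⟨y, rfl⟩ := (cell l).surjective x
  have := rotation_pow_cell l 1 y
  rw [pow_one] at this
  rw [this, row_cell, row_cell]

theorem rotation_transitive (l : Comp r n) (x y : Fin r) (h : row l x = row l y) :
    ∃ m : ℕ, (rotation l ^ m) x = y := by
  obtain ⟨⟨i, a⟩, rfl⟩ := (cell l).surjective x
  obtain ⟨⟨j, b⟩, rfl⟩ := (cell l).surjective y
  rw [row_cell, row_cell] at h
  change i = j at h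
  subst h
  obtain ⟨m, hm⟩ := finRotate_transitive _ a b
  exact ⟨m, by rw [rotation_pow_cell, hm]⟩

theorem rotation_pow_eq_one {l : Comp r n} {p : ℕ} [hp : Fact p.Prime] (hl : IsPPartition p l) :
    rotation l ^ p ^ r = 1 := by
  refine Equiv.ext fun x => ?_
  obtain ⟨⟨i, a⟩, rfl⟩ := (cell l).surjective x
  rw [rotation_pow_cell, Equiv.Perm.one_apply]
  have hle : l.1 i ≤ r :=
    (Finset.single_le_sum (fun _ _ => Nat.zero_le _) (Finset.mem_univ i)).trans l.2.le
  obtain ⟨t, ht⟩ : ∃ t, l.1 i = p ^ t := (hl.2 i).resolve_left (by have := a.2; omega)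
  -- The exponent `p ^ r` works for all rows at once: `t < p ^ t ≤ r`.
  have htr : t ≤ r := (Nat.lt_pow_self hp.out.one_lt).le.trans (ht ▸ hle)
  obtain ⟨q, hq⟩ : l.1 i ∣ p ^ r := ht ▸ pow_dvd_pow p htr
  rw [hq, pow_mul, finRotate_pow_self, one_pow]
  rfl

end Rotation

/-! ### Basis elements outside the ideal are row maps -/

section Colourings

variable {r n : ℕ} {S : TransMonoid r}

/-- The number of points of colour `t` which `α` maps to `v`. -/
noncomputable def colourCount {T : Type*} (c : Fin r → T) (α : PT r) (t : T) (v : Fin (r + 1)) :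
    ℕ := Nat.card {x : Fin r // c x = t ∧ α.app x.succ = v}

theorem permHom_app_injective (σ : Equiv.Perm (Fin r)) :
    Function.Injective (permHom r σ).app := by
  intro v w h
  have := congrArg (permHom r σ⁻¹).app h
  simpa only [← PT.mul_app, ← map_mul, inv_mul_cancel, map_one, PT.one_app] using this

/-- The equation `σα = απ` says that `π` carries the fibre of `α` over `i` to the fibre over `σ i`.
A colour-preserving such `π` exists exactly when these fibres contain equally many points of each
colour; the fibre over `0` is mapped to itself and imposes nothing. -/
theorem exists_colour_perm_iff {T : Type*} (c : Fin r → T) (α : S.Elt)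
    (σ : Equiv.Perm (Fin r)) :
    (∃ π : Equiv.Perm (Fin r), (∀ x, c (π x) = c x) ∧ S.perm σ * α = α * S.perm π) ↔
      ∀ t i, colourCount c α.1 t (σ i).succ = colourCount c α.1 t i.succ := by
  constructor
  · rintro ⟨π, hπ, e⟩ t i
    rw [perm_mul_eq_iff] at e
    refine (Nat.card_congr (π.subtypeEquiv fun x => ?_)).symm
    rw [hπ, ← e, ← permHom_app_succ, (permHom_app_injective σ).eq_iff]
  · intro h
    obtain ⟨π, hπ⟩ := exists_perm_comp_eq
      (fun x : Fin r => (c x, (permHom r σ).app (α.1.app x.succ)))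
      (fun x : Fin r => (c x, α.1.app x.succ)) (by
        rintro ⟨t, v⟩
        obtain ⟨w, rfl⟩ : ∃ w, (permHom r σ).app w = v :=
          (Finite.injective_iff_surjective.1 (permHom_app_injective σ)) v
        simp only [Prod.mk.injEq, (permHom_app_injective σ).eq_iff]
        rcases Fin.eq_zero_or_eq_succ w with rfl | ⟨i, rfl⟩
        · rw [PT.app_zero]
        · exact (h t i).symm)
    refine ⟨π, fun x => congrArg Prod.fst (hπ x), perm_mul_eq_iff.2 fun x => ?_⟩
    exact (congrArg Prod.snd (hπ x)).symm

variable {k : Type*} [CommRing k]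

theorem perm_mul_perm_eq_iff {σ τ π : Equiv.Perm (Fin r)} :
    S.perm σ * S.perm τ = S.perm τ * S.perm π ↔ σ * τ = τ * π := by
  rw [perm_mul_eq_iff, Equiv.ext_iff]
  exact forall_congr' fun x => (Fin.succ_injective r).eq_iff

/-- Up to conjugation, `G_R(λ,α,λ)` is itself a Young subgroup `G_v`: it preserves the colouring of
targets by row and by the number of preimages in each row. If it is not all of `G_λ`, then `v < λ`,
and `f(λ,α,λ)` factors through `v`. -/
theorem f_mem_span_of_not_isStable (hn : r ≤ n) {l : Comp r n} {α : S.Elt}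
    (h : ¬ IsStable l l α) : RSchur.f k S l l α ∈ TwoSidedIdeal.span {eLT k S l} := by
  let c : Fin r → Fin n × (Fin n → ℕ) :=
    fun x => (row l x, fun j => colourCount (row l) α.1 j x.succ)
  have hGR : ∀ σ, σ ∈ GR l l α ↔ ∀ i, c (σ i) = c i := by
    intro σ
    have h1 := exists_colour_perm_iff (row l) α σ
    constructor
    · rintro ⟨hσ, π, hπ, e⟩ i
      exact Prod.ext (hσ i) (funext fun j => h1.1 ⟨π, hπ, e⟩ j i)
    · intro hc
      refine ⟨fun i => congrArg Prod.fst (hc i), ?_⟩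
      obtain ⟨π, hπ, e⟩ := h1.2 fun j i => congrFun (congrArg Prod.snd (hc i)) j
      exact ⟨π, hπ, e⟩
  obtain ⟨v, τ, hv⟩ := exists_comp_of_coloring hn c
  have hvl : compLT v l := by
    refine compLT_of_refines hv (fun x y hxy => congrArg Prod.fst hxy) ?_
    by_contra! hc
    exact h fun σ hσ => ((hGR σ).2 fun i => hc _ _ (hσ i)).2
  have hconj : ∀ σ ∈ young v, τ * σ * τ⁻¹ ∈ GR l l α := fun σ hσ => (hGR _).2 fun i => by
    have := (hv _ _).1 (hσ (τ⁻¹ i))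
    simpa using this
  have hα : S.perm τ * (S.perm τ⁻¹ * α) = α := by
    rw [← mul_assoc, ← map_mul, mul_inv_cancel, map_one, one_mul]
  have hst : IsStable v l (S.perm τ⁻¹ * α) := by
    intro σ hσ
    obtain ⟨-, π, hπ, e⟩ := hconj σ hσ
    refine ⟨π, hπ, ?_⟩
    rw [mul_assoc, ← e, ← mul_assoc, ← mul_assoc, ← map_mul, ← map_mul, mul_assoc τ,
      inv_mul_cancel_left]
  -- The factorization is `α = τ · τ⁻¹α`. The values of `n_R` match because `G_R(λ,τ,v)` is also the
  -- group preserving `c`.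
  have hmul := RSchur.f_mul_f_of_isStable (k := k) (l := l) (α := S.perm τ) hst (by
    rw [hα, nR_dc, nR_dc]
    congr 2
    ext σ
    rw [hGR]
    constructor
    · intro hc
      refine ⟨fun i => congrArg Prod.fst (hc i), τ⁻¹ * σ * τ, fun i => ?_, ?_⟩
      · rw [hv]
        simpa using hc (τ i)
      · rw [perm_mul_perm_eq_iff]
        simp [mul_assoc]
    · rintro ⟨-, π, hπ, e⟩ i
      rw [perm_mul_perm_eq_iff] at e
      have h2 := (hv _ _).1 (hπ (τ⁻¹ i))
      rw [← Equiv.Perm.mul_apply, ← e] at h2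
      simpa using h2)
  rw [hα] at hmul
  rw [← hmul]
  exact RSchur.f_mul_f_mem_span hvl _ _

/-- Here the source points are coloured. If `G_λ` can be moved past `α` using only colour-preserving
permutations, then `ατ` is stable from `λ` to the smaller composition `v`, and `α = ατ · τ⁻¹`
factors `f(λ,α,λ)` through `v`. -/
theorem f_mem_span_of_colouring (hn : r ≤ n) {l : Comp r n} {α : S.Elt} {T : Type*}
    {c : Fin r → T} (hc : ∀ x y, c x = c y → row l x = row l y)
    (hs : ∃ x y, row l x = row l y ∧ c x ≠ c y)
    (hα : ∀ σ ∈ young l, ∃ π : Equiv.Perm (Fin r), (∀ x, c (π x) = c x) ∧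
      S.perm σ * α = α * S.perm π) :
    RSchur.f k S l l α ∈ TwoSidedIdeal.span {eLT k S l} := by
  obtain ⟨v, τ, hv⟩ := exists_comp_of_coloring hn c
  have hαl : IsStable l l α := fun σ hσ => by
    obtain ⟨π, hπ, e⟩ := hα σ hσ
    exact ⟨π, fun x => hc _ _ (hπ x), e⟩
  have hαv : IsStable l v (α * S.perm τ) := fun σ hσ => by
    obtain ⟨π, hπ, e⟩ := hα σ hσ
    refine ⟨τ⁻¹ * π * τ, fun x => ?_, ?_⟩
    · rw [hv]
      simpa using hπ (τ x)
    · rw [← mul_assoc, e, mul_assoc, mul_assoc, ← map_mul, ← map_mul]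
      simp [mul_assoc]
  have hτ : IsStable (S := S) v l (S.perm τ⁻¹) := fun σ hσ => by
    refine ⟨τ * σ * τ⁻¹, fun x => ?_, ?_⟩
    · have := (hv _ _).1 (hσ (τ⁻¹ x))
      exact hc _ _ (by simpa using this)
    · rw [perm_mul_perm_eq_iff]
      simp [mul_assoc]
  have hαe : α * S.perm τ * S.perm τ⁻¹ = α := by
    rw [mul_assoc, ← map_mul, mul_inv_cancel, map_one, mul_one]
  have hmul := RSchur.f_mul_f_of_isStable (k := k) (l := l) (α := α * S.perm τ) hτ (by
    rw [hαe, hαl.nR_eq, hαv.nR_eq])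
  rw [hαe] at hmul
  rw [← hmul]
  exact RSchur.f_mul_f_mem_span (compLT_of_refines hv hc hs) _ _

/-- The row containing `v`, or `none` if `v = 0`. -/
def imageRow (l : Comp r n) (v : Fin (r + 1)) : Option (Fin n) :=
  Fin.cases (motive := fun _ => Option (Fin n)) none (fun u => some (row l u)) v

@[simp] theorem imageRow_zero (l : Comp r n) : imageRow l 0 = none := rfl

@[simp] theorem imageRow_succ (l : Comp r n) (u : Fin r) :
    imageRow l u.succ = some (row l u) := rfl

theorem imageRow_eq_none {l : Comp r n} {v : Fin (r + 1)} : imageRow l v = none ↔ v = 0 := by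
  rcases Fin.eq_zero_or_eq_succ v with rfl | ⟨i, rfl⟩ <;> simp

theorem imageRow_eq_some {l : Comp r n} {v : Fin (r + 1)} {j : Fin n} :
    imageRow l v = some j ↔ ∃ u, v = u.succ ∧ row l u = j := by
  rcases Fin.eq_zero_or_eq_succ v with rfl | ⟨i, rfl⟩
  · simpa using fun u (h : (0 : Fin (r + 1)) = u.succ) => absurd h.symm (Fin.succ_ne_zero u)
  · simp

/-- `α` maps every row either to `0` or bijectively onto a row. -/
structure IsRowMap (l : Comp r n) (α : PT r) : Prop where
  inj : ∀ x y : Fin r, row l x = row l y → α.app x.succ = α.app y.succ → α.app x.succ ≠ 0 → x = y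
  surj : ∀ x u u' : Fin r, α.app x.succ = u.succ → row l u = row l u' →
    ∃ x', row l x' = row l x ∧ α.app x'.succ = u'.succ
  imageRow_eq : ∀ x y : Fin r, row l x = row l y →
    imageRow l (α.app x.succ) = imageRow l (α.app y.succ)

/-- A row meets the fibre over a non-zero point at most once, and it meets the fibres over `i` and
`σ i` simultaneously, since these lie in one row. -/
theorem IsRowMap.isStable {l : Comp r n} {α : S.Elt} (h : IsRowMap l α.1) : IsStable l l α := by
  intro σ hσ
  refine (exists_colour_perm_iff (row l) α σ).2 fun j i => ?_
  have hsub : ∀ u : Fin r, Subsingleton {x : Fin r // row l x = j ∧ α.1.app x.succ = u.succ} :=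
    fun u => ⟨fun x y => Subtype.ext (h.inj _ _ (x.2.1.trans y.2.1.symm)
      (x.2.2.trans y.2.2.symm) (x.2.2.trans_ne (Fin.succ_ne_zero u)))⟩
  have := hsub i
  have := hsub (σ i)
  refine Nat.card_congr (equivOfSubsingletonOfSubsingleton (fun x => ?_) (fun x => ?_))
  · have := h.surj _ _ _ x.2.2 (hσ i)
    exact ⟨this.choose, this.choose_spec.1.trans x.2.1, this.choose_spec.2⟩
  · have := h.surj _ _ _ x.2.2 (hσ i).symm
    exact ⟨this.choose, this.choose_spec.1.trans x.2.1, this.choose_spec.2⟩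

theorem swap_mem_young {l : Comp r n} {u u' : Fin r} (h : row l u = row l u') :
    Equiv.swap u u' ∈ young l := by
  intro x
  rcases eq_or_ne x u with rfl | hu
  · rw [Equiv.swap_apply_left, h]
  · rcases eq_or_ne x u' with rfl | hu'
    · rw [Equiv.swap_apply_right, h]
    · rw [Equiv.swap_apply_of_ne_of_ne hu hu']

/-- The rank numbers the points of each row having a common image, so how many of them have rank `t`
depends only on their total number. -/
theorem exists_rank (l : Comp r n) (α : PT r) : ∃ rank : Fin r → ℕ,
    (∀ x y, row l x = row l y → α.app x.succ = α.app y.succ → rank x = rank y → x = y) ∧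
    ∀ j v t, Nat.card {x : Fin r // (row l x = j ∧ α.app x.succ = v) ∧ rank x = t} =
      Nat.card {b : Fin (colourCount (row l) α j v) // b.val = t} := by
  let e : ∀ j v, {x : Fin r // row l x = j ∧ α.app x.succ = v} ≃
      Fin (colourCount (row l) α j v) := fun j v => Finite.equivFin _
  let rank : Fin r → ℕ := fun x => (e (row l x) (α.app x.succ) ⟨x, rfl, rfl⟩).val
  have hrank : ∀ j v (x : {x : Fin r // row l x = j ∧ α.app x.succ = v}),
      rank x.1 = (e j v x).val := by
    rintro j v ⟨x, rfl, rfl⟩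
    rfl
  refine ⟨rank, fun x y h1 h2 h3 => ?_, fun j v t => ?_⟩
  · have h4 := hrank _ _ ⟨x, rfl, rfl⟩
    have h5 := hrank _ _ ⟨y, h1.symm, h2.symm⟩
    have h6 := (e _ _).injective (Fin.ext (h4.symm.trans (h3.trans h5)))
    exact congrArg Subtype.val h6
  · refine Nat.card_congr (Equiv.trans (Equiv.subtypeSubtypeEquivSubtypeInter _ _).symm
      ((e j v).subtypeEquiv fun x => ?_))
    rw [hrank]

/-- Colour points by row, row of the image and rank. Stability makes this colouring admissible for
`f_mem_span_of_colouring`, so it cannot refine the rows strictly. A constant image row and a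
constant rank on each row give the claims. Injectivity includes the value `0`: only rows of length
one can be sent to `0`. -/
theorem isRowMap_of_f_not_mem (hn : r ≤ n) {l : Comp r n} {α : S.Elt}
    (h : RSchur.f k S l l α ∉ TwoSidedIdeal.span {eLT k S l}) :
    IsRowMap l α.1 ∧ ∀ x y, row l x = row l y → α.1.app x.succ = α.1.app y.succ → x = y := by
  have hst : IsStable l l α := by
    by_contra hc
    exact h (f_mem_span_of_not_isStable hn hc)
  obtain ⟨rank, hr1, hr2⟩ := exists_rank l α.1
  let c : Fin r → Fin n × Option (Fin n) × ℕ :=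
    fun x => (row l x, imageRow l (α.1.app x.succ), rank x)
  have hcol : ∀ x y, row l x = row l y → c x = c y := by
    by_contra! hc
    refine h (f_mem_span_of_colouring hn (c := c) (fun x y hxy => congrArg Prod.fst hxy) hc ?_)
    intro σ hσ
    refine (exists_colour_perm_iff c α σ).2 ?_
    rintro ⟨j, o, t⟩ i
    have hcount : ∀ u : Fin r, o = some (row l u) → colourCount c α.1 (j, o, t) u.succ =
        Nat.card {b : Fin (colourCount (row l) α.1 j u.succ) // b.val = t} := by
      rintro u rfl
      rw [← hr2]
      refine Nat.card_congr (Equiv.subtypeEquivRight fun x => ?_)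
      simp only [c, Prod.mk.injEq]
      constructor
      · rintro ⟨⟨h1, -, h3⟩, h4⟩
        exact ⟨⟨h1, h4⟩, h3⟩
      · rintro ⟨⟨h1, h2⟩, h3⟩
        exact ⟨⟨h1, by rw [h2, imageRow_succ], h3⟩, h2⟩
    -- Colours whose image row differs from that of `i` do not occur over `i` or `σ i`. For the
    -- others the count depends only on the size of the fibre within row `j`, which stability
    -- equates.
    by_cases ho : o = some (row l i)
    · rw [hcount i ho, hcount (σ i) (by rw [ho, hσ i])]
      obtain ⟨π, hπ, e⟩ := hst σ hσ
      rw [(exists_colour_perm_iff (row l) α σ).1 ⟨π, hπ, e⟩ j i]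
    · refine Nat.card_congr (Equiv.subtypeEquivRight fun x => iff_of_false ?_ ?_)
      · rintro ⟨h1, h2⟩
        refine ho ?_
        rw [← hσ i, ← imageRow_succ, ← h2]
        exact (congrArg (fun z => z.2.1) h1).symm
      · rintro ⟨h1, h2⟩
        refine ho ?_
        rw [← imageRow_succ, ← h2]
        exact (congrArg (fun z => z.2.1) h1).symm
  have hinj : ∀ x y, row l x = row l y → α.1.app x.succ = α.1.app y.succ → x = y :=
    fun x y hxy he => hr1 x y hxy he (congrArg (fun z => z.2.2) (hcol x y hxy))
  refine ⟨⟨fun x y hxy he _ => hinj x y hxy he, fun x u u' hu huu => ?_,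
    fun x y hxy => congrArg (fun z => z.2.1) (hcol x y hxy)⟩, hinj⟩
  -- Moving the transposition of `u` and `u'` past `α` turns a preimage of `u` into one of `u'` in
  -- the same row.
  obtain ⟨π, hπ, e⟩ := hst _ (swap_mem_young huu)
  refine ⟨π x, hπ x, ?_⟩
  rw [← perm_mul_eq_iff.1 e, hu, permHom_app_succ, Equiv.swap_apply_left]

/-- A row not sent to `0` is mapped injectively into one row, by constancy of the image row, and
onto it. -/
theorem IsRowMap.row_len_eq {l : Comp r n} {α : PT r} (h : IsRowMap l α) {x u : Fin r}
    (hx : α.app x.succ = u.succ) : l.1 (row l x) = l.1 (row l u) := by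
  rw [row_card_eq, row_card_eq]
  apply le_antisymm
  · have : ∀ y : {y : Fin r // row l y = row l x}, ∃ w : {w : Fin r // row l w = row l u},
        α.app y.1.succ = w.1.succ := by
      rintro ⟨y, hy⟩
      have h1 := h.imageRow_eq y x hy
      rw [hx, imageRow_succ, imageRow_eq_some] at h1
      obtain ⟨w, hw, hw'⟩ := h1
      exact ⟨⟨w, hw'⟩, hw⟩
    choose t ht using this
    refine Nat.card_le_card_of_injective t fun a b hab => Subtype.ext ?_
    exact h.inj _ _ (a.2.trans b.2.symm) (by rw [ht, ht, hab])
      (by rw [ht]; exact Fin.succ_ne_zero _)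
  · have : ∀ w : {w : Fin r // row l w = row l u}, ∃ y : {y : Fin r // row l y = row l x},
        α.app y.1.succ = w.1.succ := by
      rintro ⟨w, hw⟩
      obtain ⟨y, hy, hy'⟩ := h.surj x u w hx hw.symm
      exact ⟨⟨y, hy⟩, hy'⟩
    choose t ht using this
    refine Nat.card_le_card_of_injective t fun a b hab => Subtype.ext ?_
    exact Fin.succ_injective _ (by rw [← ht, ← ht, hab])

theorem row_len_eq_one_of_forall {l : Comp r n} {x : Fin r}
    (h : ∀ y, row l y = row l x → y = x) : l.1 (row l x) = 1 := by
  rw [row_card_eq, Nat.card_eq_one_iff_unique]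
  exact ⟨⟨fun a b => Subtype.ext ((h _ a.2).trans (h _ b.2).symm)⟩, ⟨⟨x, rfl⟩⟩⟩

/-- The idempotent which maps row `j` to `0` and fixes all other points. -/
def killRow (l : Comp r n) (j : Fin n) : PT r :=
  PT.mk fun x => if row l x = j then 0 else x.succ

theorem killRow_app_succ (l : Comp r n) (j : Fin n) (x : Fin r) :
    (killRow l j).app x.succ = if row l x = j then 0 else x.succ := PT.mk_app_succ _ _

theorem mem_rook_of_succ {m : ℕ} {α : PT m}
    (h : ∀ x y : Fin m, α.app x.succ = α.app y.succ → α.app x.succ ≠ 0 → x = y) : α ∈ rook m := by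
  intro i hi x y hx hy
  rcases Fin.eq_zero_or_eq_succ x with rfl | ⟨x, rfl⟩
  · exact absurd (hx.symm.trans α.app_zero) hi
  rcases Fin.eq_zero_or_eq_succ y with rfl | ⟨y, rfl⟩
  · exact absurd (hy.symm.trans α.app_zero) hi
  rw [h x y (hx.trans hy.symm) (hx.trans_ne hi)]

theorem killRow_mem_rook (l : Comp r n) (j : Fin n) : killRow l j ∈ rook r := by
  refine mem_rook_of_succ fun x y hxy h0 => ?_
  rw [killRow_app_succ] at hxy h0
  split_ifs at hxy h0 with h
  · exact absurd rfl h0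
  · rw [killRow_app_succ] at hxy
    split_ifs at hxy with h'
    · exact absurd hxy h0
    · exact Fin.succ_injective _ hxy

/-- If a large row is missed at one point, it is missed entirely, and the idempotent `η` killing it
satisfies `ηα = α`. As `η` is not injective on that row, `f(λ,η,λ)` lies in the ideal, and so does
its product with `f(λ,α,λ)`, which is `f(λ,α,λ)`. -/
theorem hitsLargeRows_of_f_not_mem (hn : r ≤ n) (hS : rook r ≤ S.toSubmonoid) {l : Comp r n}
    {α : S.Elt} (h : RSchur.f k S l l α ∉ TwoSidedIdeal.span {eLT k S l}) :
    HitsLargeRows l α.1 := by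
  obtain ⟨hrow, -⟩ := isRowMap_of_f_not_mem hn h
  intro x hx
  by_contra! hc
  let η : S.Elt := ⟨killRow l (row l x), hS (killRow_mem_rook _ _)⟩
  have hη : ∀ y : Fin r, η.1.app y.succ = if row l y = row l x then 0 else y.succ :=
    killRow_app_succ _ _
  have hηs : IsStable l l η := by
    intro σ hσ
    refine ⟨σ, hσ, perm_mul_eq_iff.2 fun y => ?_⟩
    rw [hη, hη, hσ y]
    split_ifs <;> simp
  have hmem : RSchur.f k S l l η ∈ TwoSidedIdeal.span {eLT k S l} := by
    by_contra hη'
    have := (isRowMap_of_f_not_mem hn hη').2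
    rw [row_len_eq_one_of_forall fun y hy => this y x hy (by rw [hη, hη, if_pos hy, if_pos rfl])]
      at hx
    exact lt_irrefl _ hx
  have hηα : η * α = α := by
    refine Subtype.ext (PT.ext fun y => ?_)
    change η.1.app (α.1.app y) = α.1.app y
    rcases Fin.eq_zero_or_eq_succ (α.1.app y) with h0 | ⟨u, hu⟩
    · rw [h0, PT.app_zero]
    · rw [hu, hη, if_neg]
      intro hux
      rcases Fin.eq_zero_or_eq_succ y with rfl | ⟨y, rfl⟩
      · rw [PT.app_zero] at hu
        exact Fin.succ_ne_zero u hu.symm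
      · obtain ⟨z, -, hz⟩ := hrow.surj y u x hu hux
        exact hc _ hz
  have hmul := RSchur.f_mul_f_of_isStable (k := k) (l := l) (α := η) hrow.isStable (by
    rw [hηα, hrow.isStable.nR_eq, hηs.nR_eq])
  rw [hηα] at hmul
  rw [← hmul] at h
  exact h (TwoSidedIdeal.mul_mem_right _ _ _ hmem)

/-- Row maps inducing the same map on rows agree up to a permutation of each row. -/
theorem IsRowMap.exists_young {l : Comp r n} {α β : PT r} (hα : IsRowMap l α)
    (hβ : IsRowMap l β)
    (hinj : ∀ x y : Fin r, row l x = row l y → α.app x.succ = α.app y.succ → x = y)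
    (h : ∀ x : Fin r, imageRow l (β.app x.succ) = imageRow l (α.app x.succ)) :
    ∃ π ∈ young l, ∀ x : Fin r, α.app (π x).succ = β.app x.succ := by
  have hzero : ∀ x : Fin r, β.app x.succ = 0 ↔ α.app x.succ = 0 := fun x => by
    rw [← imageRow_eq_none (l := l), h, imageRow_eq_none]
  -- Injectivity of `β` on rows sent to `0` is inherited from `α`, which kills the same rows.
  have hinj' : ∀ x y : Fin r, row l x = row l y → β.app x.succ = β.app y.succ → x = y := by
    intro x y hxy he
    by_cases h0 : β.app x.succ = 0
    · exact hinj x y hxy (by rw [(hzero x).1 h0, (hzero y).1 (he.symm.trans h0)])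
    · exact hβ.inj x y hxy he h0
  have transfer : ∀ {α β : PT r}, IsRowMap l β →
      (∀ x : Fin r, imageRow l (β.app x.succ) = imageRow l (α.app x.succ)) →
      ∀ (x : Fin r), ∃ y, row l y = row l x ∧ β.app y.succ = α.app x.succ := by
    intro α β hβ h x
    rcases Fin.eq_zero_or_eq_succ (α.app x.succ) with h0 | ⟨u, hu⟩
    · refine ⟨x, rfl, ?_⟩
      rw [h0, ← imageRow_eq_none (l := l), h, h0, imageRow_zero]
    · have h1 := h x
      rw [hu, imageRow_succ, imageRow_eq_some] at h1
      obtain ⟨w, hw, hwu⟩ := h1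
      rw [hu]
      exact hβ.surj x w u hw hwu
  obtain ⟨π, hπ⟩ := exists_perm_comp_eq (fun x : Fin r => (row l x, β.app x.succ))
    (fun x : Fin r => (row l x, α.app x.succ)) (by
      rintro ⟨j, v⟩
      simp only [Prod.mk.injEq]
      have : Subsingleton {x : Fin r // row l x = j ∧ β.app x.succ = v} :=
        ⟨fun x y => Subtype.ext (hinj' _ _ (x.2.1.trans y.2.1.symm) (x.2.2.trans y.2.2.symm))⟩
      have : Subsingleton {x : Fin r // row l x = j ∧ α.app x.succ = v} :=
        ⟨fun x y => Subtype.ext (hinj _ _ (x.2.1.trans y.2.1.symm) (x.2.2.trans y.2.2.symm))⟩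
      refine Nat.card_congr (equivOfSubsingletonOfSubsingleton (fun x => ?_) (fun x => ?_))
      · have := transfer hα (fun x => (h x).symm) x.1
        exact ⟨this.choose, this.choose_spec.1.trans x.2.1, this.choose_spec.2.trans x.2.2⟩
      · have := transfer hβ h x.1
        exact ⟨this.choose, this.choose_spec.1.trans x.2.1, this.choose_spec.2.trans x.2.2⟩)
  exact ⟨π, fun x => congrArg Prod.fst (hπ x), fun x => congrArg Prod.snd (hπ x)⟩

end Colourings

/-! ### The image of `φ_λ` and its double cosets -/

section Phi

theorem nthRow_injective {r n p : ℕ} {l : Comp r n} (i : ℕ) :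
    Function.Injective fun a => (nthRow p l i a : Fin n) :=
  fun _ _ h => (Finset.orderIsoOfFin _ rfl).injective (Subtype.ext h)

/-- The row named by an element of `{0,…,s_i}`, or `none` for `0`. -/
def rowOfIndex {r n p : ℕ} (l : Comp r n) (i : ℕ) (w : Fin (mult p l i + 1)) : Option (Fin n) :=
  Fin.cases (motive := fun _ => Option (Fin n)) none (fun a => some (nthRow p l i a : Fin n)) w

theorem rowOfIndex_injective {r n p : ℕ} {l : Comp r n} (i : ℕ) :
    Function.Injective (rowOfIndex (p := p) l i) := by
  intro v w h
  rcases Fin.eq_zero_or_eq_succ v with rfl | ⟨v, rfl⟩ <;>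
    rcases Fin.eq_zero_or_eq_succ w with rfl | ⟨w, rfl⟩
  · rfl
  · cases h
  · cases h
  · exact congrArg Fin.succ (nthRow_injective i (Option.some_injective _ h))

variable {r n p : ℕ} [hp : Fact p.Prime] {l : Comp r n} (hl : IsPPartition p l)

theorem row_label (i : ℕ) (a : Fin (mult p l i)) (b : Fin (p ^ i)) :
    row l (label hl ⟨i, a, b⟩) = nthRow p l i a :=
  row_cell l _

theorem row_len_label (i : ℕ) (a : Fin (mult p l i)) (b : Fin (p ^ i)) :
    l.1 (row l (label hl ⟨i, a, b⟩)) = p ^ i :=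
  (congrArg l.1 (row_label hl i a b)).trans (nthRow_len p l i a)

theorem exists_label (x : Fin r) : ∃ i a b, label hl ⟨i, a, b⟩ = x := by
  obtain ⟨⟨i, a, b⟩, h⟩ := (label hl).surjective x
  exact ⟨i, a, b, h⟩

theorem exists_label_of_row_eq {x : Fin r} {i : ℕ} {a : Fin (mult p l i)}
    (h : row l x = nthRow p l i a) : ∃ b, label hl ⟨i, a, b⟩ = x := by
  obtain ⟨i', a', b', rfl⟩ := exists_label hl x
  have hlen : p ^ i' = p ^ i := by
    rw [← row_len_label hl i' a' b', congrArg l.1 h, nthRow_len]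
  obtain rfl := Nat.pow_right_injective hp.out.two_le hlen
  rw [row_label] at h
  rw [nthRow_injective _ h]
  exact ⟨b', rfl⟩

theorem phi_app_label (A : ∀ i, PT (mult p l i)) (i : ℕ) (a : Fin (mult p l i))
    (b : Fin (p ^ i)) : (phi hl A).app (label hl ⟨i, a, b⟩).succ =
      Fin.cases (motive := fun _ => Fin (r + 1)) 0 (fun a' => (label hl ⟨i, a', b⟩).succ)
        ((A i).app a.succ) :=
  congrArg (fun y : Σ i : ℕ, Fin (mult p l i) × Fin (p ^ i) =>
    Fin.cases (motive := fun _ => Fin (r + 1)) 0 (fun a' => (label hl ⟨y.1, a', y.2.2⟩).succ)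
      ((A y.1).app y.2.1.succ)) ((label hl).symm_apply_apply ⟨i, a, b⟩)

theorem imageRow_phi (A : ∀ i, PT (mult p l i)) (i : ℕ) (a : Fin (mult p l i))
    (b : Fin (p ^ i)) : imageRow l ((phi hl A).app (label hl ⟨i, a, b⟩).succ) =
      rowOfIndex l i ((A i).app a.succ) := by
  rw [phi_app_label]
  rcases Fin.eq_zero_or_eq_succ ((A i).app a.succ) with h | ⟨w, h⟩
  · rw [h]
    rfl
  · rw [h, Fin.cases_succ, imageRow_succ, row_label]
    rfl

theorem phi_isRowMap (A : ∀ i, PT (mult p l i)) : IsRowMap l (phi hl A) where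
  inj := by
    intro x y hxy he h0
    obtain ⟨i, a, b, rfl⟩ := exists_label hl x
    rw [row_label] at hxy
    obtain ⟨b', rfl⟩ := exists_label_of_row_eq hl hxy.symm
    rw [phi_app_label] at he h0
    rw [phi_app_label] at he
    rcases Fin.eq_zero_or_eq_succ ((A i).app a.succ) with h | ⟨w, h⟩
    · rw [h] at h0
      exact absurd rfl h0
    · rw [h, Fin.cases_succ, Fin.cases_succ] at he
      have := (label hl).injective (Fin.succ_injective _ he)
      simp only [Sigma.mk.injEq, heq_eq_eq, Prod.mk.injEq, true_and] at this
      rw [this]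
  surj := by
    intro x u u' hu huu
    obtain ⟨i, a, b, rfl⟩ := exists_label hl x
    rw [phi_app_label] at hu
    rcases Fin.eq_zero_or_eq_succ ((A i).app a.succ) with h | ⟨w, h⟩
    · rw [h] at hu
      exact absurd hu.symm (Fin.succ_ne_zero u)
    · rw [h, Fin.cases_succ] at hu
      obtain rfl := Fin.succ_injective _ hu
      rw [row_label] at huu
      obtain ⟨b', rfl⟩ := exists_label_of_row_eq hl huu.symm
      refine ⟨label hl ⟨i, a, b'⟩, by rw [row_label, row_label], ?_⟩
      rw [phi_app_label, h, Fin.cases_succ]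
  imageRow_eq := by
    intro x y hxy
    obtain ⟨i, a, b, rfl⟩ := exists_label hl x
    rw [row_label] at hxy
    obtain ⟨b', rfl⟩ := exists_label_of_row_eq hl hxy.symm
    rw [imageRow_phi, imageRow_phi]

/-- `A` can be read off from the induced map on rows. Allowing `y` to be any point of the row of `x`
absorbs permutations within rows. -/
theorem eq_of_imageRow_phi_eq {A B : ∀ i, PT (mult p l i)}
    (h : ∀ x y : Fin r, row l x = row l y →
      imageRow l ((phi hl A).app x.succ) = imageRow l ((phi hl B).app y.succ)) : A = B := by
  funext i
  refine PT.ext fun v => ?_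
  rcases Fin.eq_zero_or_eq_succ v with rfl | ⟨a, rfl⟩
  · rw [PT.app_zero, PT.app_zero]
  · have b : Fin (p ^ i) := ⟨0, pow_pos hp.out.pos i⟩
    have := h (label hl ⟨i, a, b⟩) _ rfl
    rw [imageRow_phi, imageRow_phi] at this
    exact rowOfIndex_injective i this

theorem phi_injective : Function.Injective (phi hl) := fun _ B h =>
  eq_of_imageRow_phi_eq hl fun _ _ hxy => by rw [h, (phi_isRowMap hl B).imageRow_eq _ _ hxy]

theorem imageRow_permHom {σ : Equiv.Perm (Fin r)} (hσ : σ ∈ young l) (v : Fin (r + 1)) :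
    imageRow l ((permHom r σ).app v) = imageRow l v := by
  rcases Fin.eq_zero_or_eq_succ v with rfl | ⟨u, rfl⟩
  · rw [PT.app_zero]
  · rw [permHom_app_succ, imageRow_succ, imageRow_succ, hσ u]

theorem phi_eq_of_dc_eq {S : TransMonoid r} {A B : ∀ i, PT (mult p l i)}
    {α β : S.Elt} (hα : phi hl A = α.1) (hβ : phi hl B = β.1) (h : dc S l l α = dc S l l β) :
    A = B := by
  obtain ⟨σ, hσ, π, hπ, rfl⟩ := dc_eq_iff.1 h
  refine eq_of_imageRow_phi_eq hl fun _ y hxy => ?_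
  rw [hβ]
  change _ = imageRow l ((permHom r σ).app (α.1.app (π y).succ))
  rw [imageRow_permHom hσ, ← hα]
  exact (phi_isRowMap hl A).imageRow_eq _ _ (hxy.trans (hπ y).symm)

theorem permHom_mem_rook {m : ℕ} (σ : Equiv.Perm (Fin m)) : permHom m σ ∈ rook m :=
  mem_rook_of_succ fun _ _ h _ => σ.injective (Fin.succ_injective _ h)

theorem mem_symSub_of_surj {m : ℕ} {α : PT m} (h : ∀ a' : Fin m, ∃ a : Fin m,
    α.app a.succ = a'.succ) : α ∈ symSub m := by
  choose s hs using h
  have hinj : Function.Injective s := fun a b hab =>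
    Fin.succ_injective _ (by rw [← hs a, ← hs b, hab])
  let e := Equiv.ofBijective s (Finite.injective_iff_bijective.1 hinj)
  refine ⟨e.symm, PT.ext fun v => ?_⟩
  rcases Fin.eq_zero_or_eq_succ v with rfl | ⟨a, rfl⟩
  · rw [PT.app_zero, PT.app_zero]
  · obtain ⟨b, rfl⟩ := e.surjective a
    rw [permHom_app_succ, Equiv.symm_apply_apply]
    exact (hs b).symm

theorem phi_hitsLargeRows {A : ∀ i, PT (mult p l i)}
    (hA : ∀ i, 0 < i → A i ∈ symSub (mult p l i)) : HitsLargeRows l (phi hl A) := by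
  intro x hx
  obtain ⟨i, a, b, rfl⟩ := exists_label hl x
  rw [row_len_label] at hx
  have hi : 0 < i := Nat.pos_of_ne_zero fun h => by
    rw [h, pow_zero] at hx
    exact lt_irrefl _ hx
  obtain ⟨σ, hσ⟩ := hA i hi
  refine ⟨(label hl ⟨i, σ⁻¹ a, b⟩).succ, ?_⟩
  rw [phi_app_label, ← hσ, permHom_app_succ, Fin.cases_succ]
  simp

/-- A row map which hits all rows of length greater than one agrees on the level of rows with an
element of `φ_λ(τ̄_{s_0} · ∏_{i>0} 𝔖_{s_i})`. -/
theorem exists_phi_of_isRowMap {α : PT r} (hα : IsRowMap l α) (hh : HitsLargeRows l α) :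
    ∃ A ∈ prodSub (p := p) l ⊤, ∀ x : Fin r,
      imageRow l ((phi hl A).app x.succ) = imageRow l (α.app x.succ) := by
  have hex : ∀ i (a : Fin (mult p l i)), ∃ w : Fin (mult p l i + 1), ∀ b,
      rowOfIndex l i w = imageRow l (α.app (label hl ⟨i, a, b⟩).succ) := by
    intro i a
    have b₀ : Fin (p ^ i) := ⟨0, pow_pos hp.out.pos i⟩
    have hb : ∀ b, imageRow l (α.app (label hl ⟨i, a, b⟩).succ) =
        imageRow l (α.app (label hl ⟨i, a, b₀⟩).succ) := fun b =>
      hα.imageRow_eq _ _ (by rw [row_label, row_label])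
    simp only [hb]
    rcases Fin.eq_zero_or_eq_succ (α.app (label hl ⟨i, a, b₀⟩).succ) with h | ⟨u, hu⟩
    · exact ⟨0, fun _ => by rw [h]; rfl⟩
    -- Row maps preserve lengths, so the image row is again one of the rows of length `p ^ i`.
    · have hlen := hα.row_len_eq hu
      rw [row_len_label] at hlen
      obtain ⟨i', a', b', rfl⟩ := exists_label hl u
      rw [row_len_label] at hlen
      obtain rfl := Nat.pow_right_injective hp.out.two_le hlen
      refine ⟨a'.succ, fun _ => ?_⟩
      rw [hu, imageRow_succ, row_label]
      rfl
  choose w hw using hex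
  have himg : ∀ x : Fin r, imageRow l ((phi hl fun i => PT.mk (w i)).app x.succ) =
      imageRow l (α.app x.succ) := by
    intro x
    obtain ⟨i, a, b, rfl⟩ := exists_label hl x
    rw [imageRow_phi, PT.mk_app_succ, hw]
  refine ⟨fun i => PT.mk (w i), ⟨trivial, fun i hi => mem_symSub_of_surj fun a' => ?_⟩, himg⟩
  have b₀ : Fin (p ^ i) := ⟨0, pow_pos hp.out.pos i⟩
  have hlen := row_len_label hl i a' b₀
  -- For `i > 0` the rows of length `p ^ i` are all hit, so the `i`-th component is surjective on
  -- `{1,…,s_i}` and hence a permutation.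
  obtain ⟨z, hz⟩ := hh (label hl ⟨i, a', b₀⟩) (by
    rw [hlen]
    exact Nat.one_lt_pow hi.ne' hp.out.one_lt)
  rcases Fin.eq_zero_or_eq_succ z with rfl | ⟨z, rfl⟩
  · rw [PT.app_zero] at hz
    exact absurd hz.symm (Fin.succ_ne_zero _)
  · have h1 := hα.row_len_eq hz
    obtain ⟨i', a, b, rfl⟩ := exists_label hl z
    rw [hlen, row_len_label] at h1
    obtain rfl := Nat.pow_right_injective hp.out.two_le h1
    refine ⟨a, rowOfIndex_injective _ ?_⟩
    refine (imageRow_phi hl (fun i => PT.mk (w i)) i' a b).symm.trans ?_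
    rw [himg, hz, imageRow_succ, row_label]
    rfl

theorem phi_mem_rook {A : ∀ i, PT (mult p l i)} (hA : ∀ i, A i ∈ rook (mult p l i)) :
    phi hl A ∈ rook r := by
  refine mem_rook_of_succ fun x y he h0 => ?_
  obtain ⟨i, a, b, rfl⟩ := exists_label hl x
  obtain ⟨j, c, d, rfl⟩ := exists_label hl y
  rw [phi_app_label] at he h0
  rw [phi_app_label] at he
  rcases Fin.eq_zero_or_eq_succ ((A i).app a.succ) with h | ⟨w, h⟩
  · rw [h] at h0
    exact absurd rfl h0
  rcases Fin.eq_zero_or_eq_succ ((A j).app c.succ) with h' | ⟨w', h'⟩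
  · rw [h, h', Fin.cases_succ] at he
    exact absurd he (Fin.succ_ne_zero _)
  rw [h, h', Fin.cases_succ, Fin.cases_succ] at he
  have := (label hl).injective (Fin.succ_injective _ he)
  obtain ⟨rfl, h2⟩ := Sigma.mk.inj_iff.1 this
  obtain ⟨rfl, rfl⟩ := Prod.mk_inj.1 (eq_of_heq h2)
  have := hA i w.succ (Fin.succ_ne_zero _) _ _ h h'
  rw [Fin.succ_injective _ this]

end Phi

/-! ### The isomorphism between `k[S']` and `C_R^λ` -/

section Isomorphism

variable {k : Type*} [Field k] {r n p : ℕ} [hp : Fact p.Prime] {l : Comp r n}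
  (hl : IsPPartition p l) (S : TransMonoid r)

theorem exists_of_mem_Sprime {γ : PT r} (h : γ ∈ Sprime hl S) :
    ∃ A ∈ prodSub (p := p) l ⊤, phi hl A = γ :=
  h.1

theorem mem_of_mem_Sprime {γ : PT r} (h : γ ∈ Sprime hl S) : γ ∈ S.toSubmonoid := h.2.2

/-- An element of `S'` as an element of `S_r`. -/
def Sprime.elt (γ : Sprime hl S) : S.Elt := ⟨γ.1, mem_of_mem_Sprime hl S γ.2⟩

theorem Sprime.isRowMap (γ : Sprime hl S) : IsRowMap l (Sprime.elt hl S γ).1 := by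
  obtain ⟨A, -, hA⟩ := exists_of_mem_Sprime hl S γ.2
  exact hA ▸ phi_isRowMap hl A

theorem Sprime.hitsLargeRows (γ : Sprime hl S) : HitsLargeRows l (Sprime.elt hl S γ).1 := by
  obtain ⟨A, hA', hA⟩ := exists_of_mem_Sprime hl S γ.2
  exact hA ▸ phi_hitsLargeRows hl hA'.2

theorem Sprime.dc_injective : Function.Injective fun γ => dc S l l (Sprime.elt hl S γ) := by
  intro γ δ h
  obtain ⟨A, -, hA⟩ := exists_of_mem_Sprime hl S γ.2
  obtain ⟨B, -, hB⟩ := exists_of_mem_Sprime hl S δ.2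
  have := phi_eq_of_dc_eq hl (α := Sprime.elt hl S γ) (β := Sprime.elt hl S δ) hA hB h
  exact Subtype.ext (by rw [← hA, ← hB, this])

variable (k)

/-- The multiplicative map `S' → C_R^λ`, `α ↦ Π_R (f(λ,α,λ))`. -/
noncomputable def SprimeToCR : Sprime hl S →* CR k S l where
  toFun γ := projR k S l (fCorner k S l (Sprime.elt hl S γ))
  map_one' := map_one (projR k S l)
  map_mul' γ δ := by
    rw [← map_mul]
    congr 1
    have hγ := (Sprime.isRowMap hl S γ).isStable
    have hδ := (Sprime.isRowMap hl S δ).isStable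
    have hmul := RSchur.f_mul_f_of_isStable (k := k) (l := l) (α := Sprime.elt hl S γ) hδ
      (by rw [(hγ.mul hδ).nR_eq, hγ.nR_eq])
    exact Subtype.ext hmul.symm

/-- The algebra homomorphism `k[S'] → C_R^λ`. -/
noncomputable def SprimeAlgHom : MonoidAlgebra k (Sprime hl S) →ₐ[k] CR k S l :=
  MonoidAlgebra.lift k _ _ (SprimeToCR k hl S)

theorem SprimeAlgHom_single (γ : Sprime hl S) :
    SprimeAlgHom k hl S (MonoidAlgebra.single γ 1) =
      projR k S l (fCorner k S l (Sprime.elt hl S γ)) := by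
  rw [SprimeAlgHom, MonoidAlgebra.lift_single, one_smul]
  rfl

theorem psi_inclS_single (γ : Sprime hl S) :
    psi hl S k (inclS hl S k (MonoidAlgebra.single γ 1)) =
      fCorner k S l (Sprime.elt hl S γ) := by
  have h1 : inclS hl S k (MonoidAlgebra.single γ 1) =
      MonoidAlgebra.single (Submonoid.inclusion (Sprime_le hl S) γ) 1 :=
    MonoidAlgebra.mapDomain_single
  rw [h1]
  change Finsupp.linearCombination k _ (Finsupp.single _ 1) = _
  rw [Finsupp.linearCombination_single, one_smul]
  rfl

theorem SprimeAlgHom_apply (x : MonoidAlgebra k (Sprime hl S)) :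
    SprimeAlgHom k hl S x = projR k S l (psi hl S k (inclS hl S k x)) := by
  have : (SprimeAlgHom k hl S).toLinearMap =
      (projR k S l).toLinearMap ∘ₗ psi hl S k ∘ₗ (inclS hl S k).toLinearMap := by
    refine (monoidBasis k _).ext fun γ => ?_
    rw [monoidBasis_apply]
    change SprimeAlgHom k hl S _ = projR k S l (psi hl S k (inclS hl S k _))
    rw [SprimeAlgHom_single, psi_inclS_single]
  exact LinearMap.congr_fun this x

/-- A coordinate of `B_R^λ`. -/
def cornerCoord (D : DC S l l) : BCorner k S l →ₗ[k] k where
  toFun x := x.1 l l D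
  map_add' _ _ := rfl
  map_smul' _ _ := rfl

/-- Distinct elements of `S'` have distinct double cosets, so coefficients in `k[S']` are
coordinates in `B_R`. -/
theorem psi_inclS_coord (x : MonoidAlgebra k (Sprime hl S)) (γ : Sprime hl S) :
    (psi hl S k (inclS hl S k x)).1 l l (dc S l l (Sprime.elt hl S γ)) =
      (monoidBasis k _).repr x γ := by
  have : cornerCoord k S (dc S l l (Sprime.elt hl S γ)) ∘ₗ psi hl S k ∘ₗ
      (inclS hl S k).toLinearMap = (monoidBasis k (Sprime hl S)).coord γ := by
    classical
    refine (monoidBasis k _).ext fun δ => ?_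
    rw [Module.Basis.coord_apply, Module.Basis.repr_self, monoidBasis_apply]
    change (psi hl S k (inclS hl S k _)).1 l l _ = _
    rw [psi_inclS_single, Finsupp.single_apply]
    change RSchur.f k S l l _ l l _ = _
    rw [RSchur.f_coord_same]
    exact if_congr ((Sprime.dc_injective hl S).eq_iff.trans eq_comm) rfl rfl
  exact LinearMap.congr_fun this x

theorem SprimeAlgHom_injective [CharP k p] : Function.Injective (SprimeAlgHom k hl S) := by
  rw [injective_iff_map_eq_zero]
  intro x hx
  rw [SprimeAlgHom_apply] at hx
  have hmem : psi hl S k (inclS hl S k x) ∈ kerIdeal k S l := Ideal.Quotient.eq_zero_iff_mem.1 hx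
  rw [mem_kerIdeal] at hmem
  refine (monoidBasis k _).ext_elem fun γ => ?_
  rw [map_zero, Finsupp.zero_apply, ← psi_inclS_coord]
  refine RSchur.coord_eq_zero_of_mem_span (p := p) (fun v hv D₁ D₂ => ?_) hmem
  exact prime_dvd_structConst (rotation_mem_young l) (rotation_pow_eq_one hl)
    (rotation_transitive l) (Sprime.isRowMap hl S γ).isStable (Sprime.hitsLargeRows hl S γ)
    hv D₁ D₂

variable {S}

theorem corner_eq_sum {rep : DC S l l → S.Elt} (hrep : ∀ D, dc S l l (rep D) = D)
    (x : BCorner k S l) : x = ∑ D, x.1 l l D • fCorner k S l (rep D) := by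
  let ι : BCorner k S l →ₗ[k] RSchur k S n := ⟨⟨fun x => x.1, fun _ _ => rfl⟩, fun _ _ => rfl⟩
  have hι : Function.Injective ι := Subtype.val_injective
  refine hι ?_
  rw [map_sum]
  have hx : x.1 = RSchur.f k S l l 1 * x.1 * RSchur.f k S l l 1 := by
    obtain ⟨y, hy⟩ := x.2
    have he := isIdempotentElem_f k S l
    rw [← hy]
    simp only [← mul_assoc]
    rw [he.eq, mul_assoc _ (RSchur.f k S l l 1) (RSchur.f k S l l 1), he.eq]
  change x.1 = ∑ D, x.1 l l D • RSchur.f k S l l (rep D)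
  ext a b E
  rw [RSchur.sum_coord]
  by_cases ha : a = l
  · by_cases hb : b = l
    · subst ha hb
      simp [RSchur.f_coord_same, hrep]
    · rw [hx, RSchur.mul_f_coord_ne _ hb]
      simp [RSchur.f_coord_right_ne hb]
  · rw [hx, mul_assoc, RSchur.f_mul_coord_ne _ ha]
    simp [RSchur.f_coord_left_ne ha]

/-- Either the class is zero, or `α` times an element of `G_λ` lies in `S'`; such a factor does not
change the double coset. -/
theorem projR_fCorner_mem_range (hn : r ≤ n) (hS : rook r ≤ S.toSubmonoid) (α : S.Elt) :
    projR k S l (fCorner k S l α) ∈ (SprimeAlgHom k hl S).range := by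
  by_cases hα : RSchur.f k S l l α ∈ TwoSidedIdeal.span {eLT k S l}
  · have : projR k S l (fCorner k S l α) = 0 := Ideal.Quotient.eq_zero_iff_mem.2 hα
    rw [this]
    exact zero_mem _
  · obtain ⟨hrow, hinj⟩ := isRowMap_of_f_not_mem hn hα
    obtain ⟨A, hA, himg⟩ := exists_phi_of_isRowMap hl hrow
      (hitsLargeRows_of_f_not_mem hn hS hα)
    obtain ⟨π, hπ, e⟩ := hrow.exists_young (phi_isRowMap hl A) hinj himg
    have hγ : phi hl A = (α * S.perm π).1 := by
      refine PT.ext fun x => ?_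
      rcases Fin.eq_zero_or_eq_succ x with rfl | ⟨x, rfl⟩
      · rw [PT.app_zero, PT.app_zero]
      · exact (e x).symm
    have hmem : (α * S.perm π).1 ∈ Sprime hl S :=
      ⟨⟨A, hA, hγ⟩, ⟨A, hγ⟩, (α * S.perm π).2⟩
    refine ⟨MonoidAlgebra.single ⟨_, hmem⟩ 1, ?_⟩
    refine (SprimeAlgHom_single k hl S _).trans (congrArg _ (Subtype.ext ?_))
    change RSchur.f k S l l (α * S.perm π) = RSchur.f k S l l α
    rw [RSchur.f, RSchur.f, dc_mul_right _ hπ]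

theorem SprimeAlgHom_surjective (hn : r ≤ n) (hS : rook r ≤ S.toSubmonoid) :
    Function.Surjective (SprimeAlgHom k hl S) := by
  intro y
  obtain ⟨x, rfl⟩ := Ideal.Quotient.mk_surjective y
  change projR k S l x ∈ (SprimeAlgHom k hl S).range
  have hrep : ∀ D : DC S l l, ∃ α, dc S l l α = D := DC.ind fun α => ⟨α, rfl⟩
  choose rep hrep using hrep
  rw [corner_eq_sum k hrep x, map_sum]
  refine sum_mem fun D _ => ?_
  rw [map_smul]
  exact Subalgebra.smul_mem _ (projR_fCorner_mem_range k hl hn hS _) _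

end Isomorphism

/-! ### Splitting off the symmetric group factors of `S'` -/

section Factorization

variable {r n p : ℕ} [hp : Fact p.Prime] {l : Comp r n} (hl : IsPPartition p l)
  (S : TransMonoid r)

/-- The elements of `τ̄_{s_0}` which lie in `S_r` when extended by the identity. -/
noncomputable def baseSub : Submonoid (PT (mult p l 0)) :=
  (S.toSubmonoid.comap (phi hl)).comap (MonoidHom.mulSingle (fun i => PT (mult p l i)) 0)

variable {S}

theorem mem_baseSub {α : PT (mult p l 0)} :
    α ∈ baseSub hl S ↔ phi hl (Pi.mulSingle 0 α) ∈ S.toSubmonoid := Iff.rfl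

theorem rook_le_baseSub (hS : rook r ≤ S.toSubmonoid) : rook (mult p l 0) ≤ baseSub hl S := by
  intro α hα
  refine (mem_baseSub hl).2 (hS (phi_mem_rook hl fun i => ?_))
  rcases eq_or_ne i 0 with rfl | hi
  · rwa [Pi.mulSingle_eq_same]
  · rw [Pi.mulSingle_eq_of_ne hi]
    exact one_mem _

/-- Since `ℜ_r ⊆ S_r`, multiplying by the image under `φ_λ` of a tuple of permutations does not
leave `S_r`. Hence membership of `φ_λ(A)` in `S_r` depends only on `A 0`, the other components being
replaceable by `1`. -/
theorem Sprime_eq_map (hS : rook r ≤ S.toSubmonoid) :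
    Sprime hl S = (prodSub l (baseSub hl S)).map (phi hl) := by
  apply le_antisymm
  · rintro γ ⟨⟨A, hA, rfl⟩, -, hγ⟩
    refine ⟨A, ⟨?_, hA.2⟩, rfl⟩
    rw [mem_baseSub]
    have : ∀ i, ∃ b ∈ rook (mult p l i),
        A i * b = Pi.mulSingle (M := fun i => PT (mult p l i)) 0 (A 0) i := by
      intro i
      rcases Nat.eq_zero_or_pos i with rfl | hi
      · exact ⟨1, one_mem _, by rw [mul_one, Pi.mulSingle_eq_same]⟩
      · obtain ⟨σ, hσ⟩ := hA.2 i hi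
        refine ⟨permHom _ σ⁻¹, permHom_mem_rook _, ?_⟩
        rw [← hσ, ← map_mul, mul_inv_cancel, map_one, Pi.mulSingle_eq_of_ne hi.ne']
    choose B hB hAB using this
    rw [← show A * B = Pi.mulSingle 0 (A 0) from funext hAB, map_mul]
    exact mul_mem hγ (hS (phi_mem_rook hl hB))
  · rintro γ ⟨A, hA, rfl⟩
    refine ⟨⟨A, ⟨trivial, hA.2⟩, rfl⟩, ⟨A, rfl⟩, ?_⟩
    have : ∀ i, ∃ b ∈ rook (mult p l i),
        Pi.mulSingle (M := fun i => PT (mult p l i)) 0 (A 0) i * b = A i := by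
      intro i
      rcases Nat.eq_zero_or_pos i with rfl | hi
      · exact ⟨1, one_mem _, by rw [mul_one, Pi.mulSingle_eq_same]⟩
      · obtain ⟨σ, hσ⟩ := hA.2 i hi
        refine ⟨A i, hσ ▸ permHom_mem_rook σ, ?_⟩
        rw [Pi.mulSingle_eq_of_ne hi.ne', one_mul]
    choose B hB hAB using this
    rw [← show Pi.mulSingle 0 (A 0) * B = A from funext hAB, map_mul]
    exact mul_mem ((mem_baseSub hl).1 hA.1) (hS (phi_mem_rook hl hB))

/-- A row of length `p ^ i` forces `i < p ^ i ≤ r`. Finiteness is needed for the basis of the tensor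
product over these indices. -/
theorem finite_mult_pos : Finite {i : ℕ // 0 < i ∧ 0 < mult p l i} := by
  refine Set.Finite.subset (Set.finite_Iic r) ?_
  rintro i ⟨-, hi⟩
  have hlen := nthRow_len p l i ⟨0, hi⟩
  have hle : l.1 (nthRow p l i ⟨0, hi⟩) ≤ r :=
    (Finset.single_le_sum (fun _ _ => Nat.zero_le _) (Finset.mem_univ _)).trans l.2.le
  exact (Nat.lt_pow_self hp.out.one_lt).le.trans (hlen ▸ hle)

end Factorization

/-! ### `S₀ · ∏ 𝔖_{s_i}` as a product over the indices with `s_i > 0` -/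

section ProductDecomposition

variable {r n p : ℕ} (l : Comp r n) (S₀ : Submonoid (PT (mult p l 0)))

/-- The inclusion `S₀ × ∏ 𝔖_{s_i} → ∏ τ̄_{s_i}`. -/
def prodHom : S₀ × (∀ i : {i : ℕ // 0 < i ∧ 0 < mult p l i}, Equiv.Perm (Fin (mult p l i))) →*
    ∀ i, PT (mult p l i) :=
  MonoidHom.pi fun
    | 0 => S₀.subtype.comp (MonoidHom.fst _ _)
    | i + 1 => if h : 0 < mult p l (i + 1) then
        (permHom _).comp ((Pi.evalMonoidHom
          (fun i : {i : ℕ // 0 < i ∧ 0 < mult p l i} => Equiv.Perm (Fin (mult p l i)))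
          ⟨i + 1, i.succ_pos, h⟩).comp (MonoidHom.snd _ _)) else 1

theorem prodHom_pos (x) (i : {i : ℕ // 0 < i ∧ 0 < mult p l i}) :
    prodHom l S₀ x i.1 = permHom _ (x.2 i) := by
  obtain ⟨i, hi, hm⟩ := i
  cases i with
  | zero => exact absurd hi (lt_irrefl 0)
  | succ i =>
    simp only [prodHom, MonoidHom.pi_apply]
    rw [dif_pos hm]
    rfl

theorem PT.eq_of_not_pos {m : ℕ} (hm : ¬ 0 < m) (α β : PT m) : α = β := by
  obtain rfl : m = 0 := by omega
  refine PT.ext fun x => ?_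
  rw [Fin.fin_one_eq_zero x, PT.app_zero, PT.app_zero]

theorem permHom_injective (m : ℕ) : Function.Injective (permHom m) := fun _ _ h =>
  Equiv.ext fun x => Fin.succ_injective _ (congrArg (fun α : PT m => α.app x.succ) h)

theorem prodHom_mem (x) : prodHom l S₀ x ∈ prodSub (p := p) l S₀ := by
  refine ⟨x.1.2, fun i hi => ?_⟩
  by_cases hm : 0 < mult p l i
  · rw [prodHom_pos l S₀ x ⟨i, hi, hm⟩]
    exact ⟨_, rfl⟩
  · rw [PT.eq_of_not_pos hm (prodHom l S₀ x i) 1]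
    exact one_mem _

theorem prodHom_bijective :
    Function.Bijective ((prodHom l S₀).codRestrict (prodSub (p := p) l S₀) (prodHom_mem l S₀)) := by
  constructor
  · intro x y h
    have h' : ∀ i, prodHom l S₀ x i = prodHom l S₀ y i :=
      fun i => congrFun (congrArg Subtype.val h) i
    refine Prod.ext (Subtype.ext (h' 0)) (funext fun i => permHom_injective _ ?_)
    rw [← prodHom_pos, ← prodHom_pos, h']
  · rintro ⟨A, hA⟩
    choose σ hσ using fun i : {i : ℕ // 0 < i ∧ 0 < mult p l i} => hA.2 i i.2.1
    refine ⟨(⟨A 0, hA.1⟩, σ), Subtype.ext (funext fun i => ?_)⟩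
    change prodHom l S₀ _ i = A i
    rcases Nat.eq_zero_or_pos i with rfl | hi
    · rfl
    · by_cases hm : 0 < mult p l i
      · rw [prodHom_pos l S₀ _ ⟨i, hi, hm⟩]
        exact hσ ⟨i, hi, hm⟩
      · exact PT.eq_of_not_pos hm _ _

end ProductDecomposition

end GenSchur

theorem proposition8p4 {r n p : ℕ} (hn : r ≤ n) [Fact p.Prime] (k : Type*) [Field k] [CharP k p]
    (S : GenSchur.TransMonoid r) (hS : GenSchur.rook r ≤ S.toSubmonoid)
    (l : GenSchur.Comp r n) (hl : GenSchur.IsPPartition p l) :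
    (∃ Φ : MonoidAlgebra k (GenSchur.Sprime hl S) ≃ₐ[k] GenSchur.CR k S l,
        ∀ x, Φ x = GenSchur.projR k S l (GenSchur.psi hl S k (GenSchur.inclS hl S k x))) ∧
    ∃ S₀ : Submonoid (GenSchur.PT (GenSchur.mult p l 0)),
      GenSchur.rook (GenSchur.mult p l 0) ≤ S₀ ∧
      GenSchur.Sprime hl S = (GenSchur.prodSub l S₀).map (GenSchur.phi hl) ∧
      Nonempty (GenSchur.CR k S l ≃ₐ[k] MonoidAlgebra k (GenSchur.prodSub (p := p) l S₀)) ∧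
      Nonempty (GenSchur.CR k S l ≃ₐ[k]
        MonoidAlgebra k S₀ ⊗[k]
          (⨂[k] i : {i : ℕ // 0 < i ∧ 0 < GenSchur.mult p l i},
            MonoidAlgebra k (Equiv.Perm (Fin (GenSchur.mult p l i))))) := by
  have hbij : Function.Bijective (GenSchur.SprimeAlgHom k hl S) :=
    ⟨GenSchur.SprimeAlgHom_injective k hl S, GenSchur.SprimeAlgHom_surjective k hl hn hS⟩
  let Φ := AlgEquiv.ofBijective (GenSchur.SprimeAlgHom k hl S) hbij
  have hSp := GenSchur.Sprime_eq_map hl hS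
  have e₁ : GenSchur.prodSub l (GenSchur.baseSub hl S) ≃* GenSchur.Sprime hl S :=
    ((GenSchur.prodSub l (GenSchur.baseSub hl S)).equivMapOfInjective _
      (GenSchur.phi_injective hl)).trans (MulEquiv.submonoidCongr hSp.symm)
  let e₂ := MulEquiv.ofBijective _ (GenSchur.prodHom_bijective l (GenSchur.baseSub hl S))
  have Ψ := Φ.symm.trans (MonoidAlgebra.domCongr k k e₁.symm)
  have : Finite {i : ℕ // 0 < i ∧ 0 < GenSchur.mult p l i} := GenSchur.finite_mult_pos
  refine ⟨⟨Φ, GenSchur.SprimeAlgHom_apply k hl S⟩, GenSchur.baseSub hl S,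
    GenSchur.rook_le_baseSub hl hS, hSp, ⟨Ψ⟩, ⟨?_⟩⟩
  exact ((Ψ.trans (MonoidAlgebra.domCongr k k e₂.symm)).trans
    (GenSchur.prodAlgEquiv k _ _)).trans
      (Algebra.TensorProduct.congr AlgEquiv.refl (GenSchur.piAlgEquiv k _))
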